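/- For $d'\in\mathbb{N}$, let $|\cdot|$ be the Euclidean norm on $\mathbb{R}^{d'}$. For a finite set $\omega\subset\mathbb{R}^{d'}$ and $s>0$, let $$E_s(\omega)=\sum_{y\in\omega}\ \sum_{\substack{x\in\omega\\ x\ne y}}\frac{1}{|x-y|^s},$$ and for $A\subset\mathbb{R}^{d'}$ and $N\in\mathbb{N}$ let $$\mathcal{E}_s(A,N)=\inf\{E_s(\omega):\ \omega\subset A,\ \omega \text{ has exactly } N \text{ points}\}\in[0,\infty],$$ where $\inf\emptyset=\infty$. A set $M\subset\mathbb{R}^{d'}$ is called a $1$-rectifiable manifold if $M=\bigcup_{k=1}^{n}\phi_k(K_k)$ for some finite $n$, where, for each $k$, $K_k\subset\mathbb{R}$ is compact and $\phi_k$ is a map into $\mathbb{R}^{d'}$ that is bi-Lipschitz on an open set $G_k\supset K_k$, i.e. there is a constant $L_k>0$ with $\frac{1}{L_k}|x-y|\le|\phi_k(x)-\phi_k(y)|\le L_k|x-y|$ for all $x,y\in G_k$. Let $\mathcal{H}_1$ denote one-dimensional Hausdorff measure on $\mathbb{R}^{d'}$, normalized so that a segment of length $1$ has measure $1$, and let $\zeta$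 be the Riemann zeta function. **Corollary 2.5.** Suppose that $A$ is a compact subset of a $1$-rectifiable manifold in $\mathbb{R}^{d'}$ and that $s>1$. Then $$\lim_{N\to\infty}\frac{\mathcal{E}_s(A,N)}{N^{1+s}}=\frac{2\zeta(s)}{\mathcal{H}_1(A)^s},$$ where the limit is taken in $[0,\infty]$ and the right-hand side is understood to be $\infty$ if $\mathcal{H}_1(A)=0$. -/

import Mathlib

open MeasureTheory Filter Topology
open scoped ENNReal

namespace RieszEnergy

/-- `φ` is bi-Lipschitz on `T` with some constant `L`:
`(1 / L) |x - y| ≤ |φ x - φ y| ≤ L |x - y|` for all `x, y ∈ T`. -/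
def IsBiLipschitzOn {X Y : Type*} [PseudoMetricSpace X] [PseudoMetricSpace Y]
    (φ : X → Y) (T : Set X) : Prop :=
  ∃ L : ℝ, 0 < L ∧ ∀ x ∈ T, ∀ y ∈ T,
    (1 / L) * dist x y ≤ dist (φ x) (φ y) ∧ dist (φ x) (φ y) ≤ L * dist x y

/-- `A ⊆ ℝ^d'` is a `d`-rectifiable manifold: a finite union of sets `φ k '' K k` with
`K k ⊆ ℝ^d` compact and `φ k` bi-Lipschitz on an open set `G k ⊇ K k` (the values of `φ k`
outside `G k` are irrelevant). -/
def IsRectifiableManifold (d : ℕ) {d' : ℕ} (A : Set (EuclideanSpace ℝ (Fin d'))) : Prop :=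
  ∃ (n : ℕ) (K G : Fin n → Set (EuclideanSpace ℝ (Fin d)))
    (φ : Fin n → EuclideanSpace ℝ (Fin d) → EuclideanSpace ℝ (Fin d')),
    (∀ k, IsCompact (K k) ∧ IsOpen (G k) ∧ K k ⊆ G k ∧ IsBiLipschitzOn (φ k) (G k)) ∧
      A = ⋃ k, φ k '' K k

open Classical in
/-- The Riesz `s`-energy of a finite set of points, summed over ordered pairs of distinct
points. -/
noncomputable def energy {d' : ℕ} (s : ℝ) (ω : Finset (EuclideanSpace ℝ (Fin d'))) : ℝ :=
  ∑ y ∈ ω, ∑ x ∈ ω.erase y, 1 / dist x y ^ s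

/-- The `N`-point minimal `s`-energy over `A`: the infimum of the energies of the `N`-point
subsets of `A`, which is `∞` if there is no such subset. -/
noncomputable def minEnergy {d' : ℕ} (s : ℝ) (A : Set (EuclideanSpace ℝ (Fin d'))) (N : ℕ) :
    ℝ≥0∞ :=
  ⨅ (ω : Finset (EuclideanSpace ℝ (Fin d'))) (_ : ω.card = N) (_ : (ω : Set _) ⊆ A),
    ENNReal.ofReal (energy s ω)

end RieszEnergy

/-! Equally spaced points on an interval of length `ℓ` have `k`-th neighbours at distance about
`kℓ/N`, so their energy is about `2ζ(s) N^(1+s) / ℓ^s`. By convexity, in the form of Radon's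
inequality, no configuration does asymptotically better: for each `k`, the gaps between `k`-th
neighbours add up to at most `kℓ`. The task is to show that `A` behaves like an interval of length
`ℋ₁(A)`.

Lipschitz curves are differentiable almost everywhere. Hence, up to a set of small measure, `A` is a
finite disjoint union of compact pieces, each with a `1`-Lipschitz real coordinate whose inverse is
`(1 + ε)`-Lipschitz (`exists_disjoint_isNearlyLinear`).

Upper bound: the coordinate image of a piece `Q` is a compact set of reals of length at least
`ℋ₁(Q)/(1 + ε)`, and its distribution function lets an interval of that length be mapped into it
without shrinking distances. Disjoint compact pieces are a positive distance apart, so pairs from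
different pieces cost only `O(N²)`, which is `o(N^(1+s))` because `s > 1`
(`HasExpandingSelection.exists_energy_le`).

Lower bound: each piece is cut along short intervals of its coordinate. Energy is superadditive over
disjoint sets, and Radon's inequality adds up the lengths (`HasEnergyLowerBound.union`). The
difficulty is the leftover `A \ K`, where `K` is the union of the pieces: its measure is small but
it may hold many points. In a configuration of energy below `t N^(1+s)` few points have a neighbour
within `c/N`. Among the others, few are farther than `θc/N` from `K`, since disjoint parameter
intervals around them miss the preimage of `K` (`card_mul_le_of_separated`). The rest are moved into
`K` at the cost of a factor close to `1` (`energy_image_le`). -/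

namespace RieszEnergy

/-! ### Convexity and summation over pairs -/

/-- Radon's inequality. -/
theorem radon_inequality {ι : Type*} (I : Finset ι) (a b : ι → ℝ) {s : ℝ} (hs : 0 < s)
    (ha : ∀ i ∈ I, 0 ≤ a i) (hb : ∀ i ∈ I, 0 < b i) :
    (∑ i ∈ I, a i) ^ (1 + s) / (∑ i ∈ I, b i) ^ s ≤ ∑ i ∈ I, a i ^ (1 + s) / b i ^ s := by
  rcases I.eq_empty_or_nonempty with rfl | hI
  · simp [Real.zero_rpow (by linarith : 1 + s ≠ 0)]
  have hB : 0 < ∑ i ∈ I, b i := Finset.sum_pos hb hI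
  set B := ∑ i ∈ I, b i with hBdef
  -- Jensen's inequality for `t ↦ t^(1+s)` at the points `a i / b i` with weights `b i / B`.
  have key := (convexOn_rpow (by linarith : 1 ≤ 1 + s)).map_sum_le (t := I)
    (w := fun i => b i / B) (p := fun i => a i / b i)
    (fun i hi => div_nonneg (hb i hi).le hB.le)
    (by rw [← Finset.sum_div, div_self hB.ne'])
    (fun i hi => div_nonneg (ha i hi) (hb i hi).le)
  have h1 : ∑ i ∈ I, (b i / B) • (a i / b i) = (∑ i ∈ I, a i) / B := by
    rw [Finset.sum_div]
    refine Finset.sum_congr rfl fun i hi => ?_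
    have := (hb i hi).ne'
    simp only [smul_eq_mul]
    field_simp
  have h2 : ∑ i ∈ I, (b i / B) • (a i / b i) ^ (1 + s)
      = (∑ i ∈ I, a i ^ (1 + s) / b i ^ s) / B := by
    rw [Finset.sum_div]
    refine Finset.sum_congr rfl fun i hi => ?_
    have h := hb i hi
    have h' := Real.rpow_pos_of_pos h s
    rw [Real.div_rpow (ha i hi) h.le, Real.rpow_add h, Real.rpow_one, smul_eq_mul]
    field_simp
  rw [h1, h2, Real.div_rpow (Finset.sum_nonneg ha) hB.le, Real.rpow_add hB, Real.rpow_one,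
    le_div_iff₀ hB] at key
  have h' := Real.rpow_pos_of_pos hB s
  calc _ = (∑ i ∈ I, a i) ^ (1 + s) / (B * B ^ s) * B := by field_simp
    _ ≤ _ := key

theorem radon_inequality_two {a₁ a₂ b₁ b₂ s : ℝ} (hs : 0 < s) (ha₁ : 0 ≤ a₁) (ha₂ : 0 ≤ a₂)
    (hb₁ : 0 < b₁) (hb₂ : 0 < b₂) :
    (a₁ + a₂) ^ (1 + s) / (b₁ + b₂) ^ s ≤ a₁ ^ (1 + s) / b₁ ^ s + a₂ ^ (1 + s) / b₂ ^ s := by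
  have := radon_inequality Finset.univ ![a₁, a₂] ![b₁, b₂] hs
    (by simp [Fin.forall_fin_two, *]) (by simp [Fin.forall_fin_two, *])
  simpa using this

/-- Each unordered pair is counted from its larger index `i`; the smaller one is written `i - 1 -
k`, so that `k + 1` is the difference of the indices. -/
theorem sum_range_erase_eq_two_mul {f : ℕ → ℕ → ℝ} (hf : ∀ i j, f i j = f j i) (n : ℕ) :
    ∑ i ∈ Finset.range n, ∑ j ∈ (Finset.range n).erase i, f i j
      = 2 * ∑ i ∈ Finset.range n, ∑ k ∈ Finset.range i, f i (i - 1 - k) := by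
  have h1 : ∀ i, ∑ k ∈ Finset.range i, f i (i - 1 - k) = ∑ j ∈ Finset.range i, f i j :=
    fun i => Finset.sum_range_reflect (f i) i
  simp only [h1]
  induction n with
  | zero => simp
  | succ n ih =>
    rw [Finset.sum_range_succ, Finset.sum_range_succ, mul_add, ← ih]
    have h2 : (Finset.range (n + 1)).erase n = Finset.range n := by
      ext j; simp; omega
    have h3 : ∀ i ∈ Finset.range n, ∑ j ∈ (Finset.range (n + 1)).erase i, f i j
        = ∑ j ∈ (Finset.range n).erase i, f i j + f n i := by
      intro i hi
      have : (Finset.range (n + 1)).erase i = insert n ((Finset.range n).erase i) := by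
        ext j; simp at hi ⊢; omega
      rw [this, Finset.sum_insert (by simp), hf n i, add_comm]
    rw [h2, Finset.sum_congr rfl h3, Finset.sum_add_distrib]
    ring

/-! ### Energy of finite sets and the one-dimensional lower bound -/

section Energy

variable {d : ℕ} {s : ℝ}

theorem energy_nonneg (ω : Finset (EuclideanSpace ℝ (Fin d))) : 0 ≤ energy s ω :=
  Finset.sum_nonneg fun _ _ => Finset.sum_nonneg fun _ _ => by positivity

open Classical in
theorem energy_mono {ω ω' : Finset (EuclideanSpace ℝ (Fin d))} (h : ω ⊆ ω') :
    energy s ω ≤ energy s ω' := by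
  unfold energy
  refine (Finset.sum_le_sum fun y _ => ?_).trans
    (Finset.sum_le_sum_of_subset_of_nonneg h fun _ _ _ => Finset.sum_nonneg fun _ _ => by positivity)
  exact Finset.sum_le_sum_of_subset_of_nonneg (Finset.erase_subset_erase y h)
    fun _ _ _ => by positivity

open Classical in
theorem energy_add_le_energy_union {ω ω' : Finset (EuclideanSpace ℝ (Fin d))}
    (h : Disjoint ω ω') : energy s ω + energy s ω' ≤ energy s (ω ∪ ω') := by
  unfold energy
  rw [Finset.sum_union h]
  refine add_le_add (Finset.sum_le_sum fun y _ => ?_) (Finset.sum_le_sum fun y _ => ?_)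
  · exact Finset.sum_le_sum_of_subset_of_nonneg
      (Finset.erase_subset_erase y Finset.subset_union_left) fun _ _ _ => by positivity
  · exact Finset.sum_le_sum_of_subset_of_nonneg
      (Finset.erase_subset_erase y Finset.subset_union_right) fun _ _ _ => by positivity

open Classical in
theorem energy_image {ι : Type*} [DecidableEq ι] {I : Finset ι}
    {x : ι → EuclideanSpace ℝ (Fin d)} (hx : Set.InjOn x I) :
    energy s (I.image x) = ∑ i ∈ I, ∑ j ∈ I.erase i, 1 / dist (x j) (x i) ^ s := by
  unfold energy
  rw [Finset.sum_image hx]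
  refine Finset.sum_congr rfl fun i hi => ?_
  have : (I.image x).erase (x i) = (I.erase i).image x := by
    ext y
    simp only [Finset.mem_erase, Finset.mem_image]
    constructor
    · rintro ⟨h, j, hj, rfl⟩
      exact ⟨j, ⟨fun h' => h (by rw [h']), hj⟩, rfl⟩
    · rintro ⟨j, ⟨h, hj⟩, rfl⟩
      exact ⟨fun h' => h (hx hj hi h'), j, hj, rfl⟩
  rw [this, Finset.sum_image (hx.mono (by simp))]

open Classical in
theorem energy_image_range {n : ℕ} {x : ℕ → EuclideanSpace ℝ (Fin d)}
    (hx : Set.InjOn x (Finset.range n)) :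
    energy s ((Finset.range n).image x) = 2 * ∑ i ∈ Finset.range n, ∑ k ∈ Finset.range i,
      1 / dist (x i) (x (i - 1 - k)) ^ s := by
  rw [energy_image hx, sum_range_erase_eq_two_mul (fun i j => by rw [dist_comm])]
  simp only [dist_comm]

/-- A finite set with an injective real coordinate can be enumerated in increasing order. -/
theorem exists_enumeration {E : Type*} [Nonempty E] [DecidableEq E] (ω : Finset E) (g : E → ℝ)
    (hg : Set.InjOn g ω) :
    ∃ x : ℕ → E, (Finset.range ω.card).image x = ω ∧
      ∀ i j, i < j → j < ω.card → g (x i) < g (x j) := by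
  have hc : (ω.image g).card = ω.card := Finset.card_image_of_injOn hg
  let e := (ω.image g).orderEmbOfFin hc
  have : ∀ i : ℕ, ∃ y, ∀ h : i < ω.card, y ∈ ω ∧ g y = e ⟨i, h⟩ := by
    intro i
    by_cases h : i < ω.card
    · have := (ω.image g).orderEmbOfFin_mem hc ⟨i, h⟩
      obtain ⟨y, hy, hy'⟩ := Finset.mem_image.1 this
      exact ⟨y, fun _ => ⟨hy, hy'⟩⟩
    · exact ⟨Classical.arbitrary E, fun h' => absurd h' h⟩
  choose x hx using this
  have hmono : ∀ i j, i < j → j < ω.card → g (x i) < g (x j) := by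
    intro i j hij hj
    rw [(hx j hj).2, (hx i (hij.trans hj)).2]
    exact e.strictMono hij
  refine ⟨x, ?_, hmono⟩
  refine Finset.eq_of_subset_of_card_le ?_ ?_
  · intro y hy
    obtain ⟨i, hi, rfl⟩ := Finset.mem_image.1 hy
    exact (hx i (Finset.mem_range.1 hi)).1
  · rw [Finset.card_image_of_injOn, Finset.card_range]
    intro i hi j hj hij
    simp only [Finset.coe_range, Set.mem_Iio] at hi hj
    by_contra hne
    rcases lt_or_gt_of_ne hne with h | h
    · exact (hmono i j h hj).ne (by rw [hij])
    · exact (hmono j i h hi).ne (by rw [hij])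

/-- The truncation `2 ∑_{k = 1}^κ k^{-s}` of `2 ζ(s)`. -/
noncomputable def partialZeta (s : ℝ) (κ : ℕ) : ℝ :=
  2 * ∑ k ∈ Finset.range κ, 1 / ((k : ℝ) + 1) ^ s

theorem partialZeta_nonneg (κ : ℕ) : 0 ≤ partialZeta s κ :=
  mul_nonneg zero_le_two (Finset.sum_nonneg fun _ _ => by positivity)

/-- The sum telescopes to the last `m` values minus the first `m` values. -/
theorem sum_shift_sub_le {v : ℕ → ℝ} {ℓ : ℝ} {n m : ℕ} (hm : m ≤ n)
    (hv : ∀ i < n, 0 ≤ v i ∧ v i ≤ ℓ) :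
    ∑ i ∈ Finset.range (n - m), (v (i + m) - v i) ≤ m * ℓ := by
  have h1 : ∑ i ∈ Finset.range n, v i
      = ∑ i ∈ Finset.range m, v i + ∑ i ∈ Finset.range (n - m), v (i + m) := by
    conv_lhs => rw [← Nat.add_sub_cancel' hm, Finset.sum_range_add]
    simp only [add_comm]
  have h2 : ∑ i ∈ Finset.range n, v i
      = ∑ i ∈ Finset.range (n - m), v i + ∑ i ∈ Finset.range m, v (n - m + i) := by
    conv_lhs => rw [← Nat.sub_add_cancel hm, Finset.sum_range_add]
  have h3 : 0 ≤ ∑ i ∈ Finset.range m, v i :=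
    Finset.sum_nonneg fun i hi => (hv i ((Finset.mem_range.1 hi).trans_le hm)).1
  have h4 : ∑ i ∈ Finset.range m, v (n - m + i) ≤ ∑ i ∈ Finset.range m, ℓ :=
    Finset.sum_le_sum fun i hi => (hv _ (by have := Finset.mem_range.1 hi; omega)).2
  rw [Finset.sum_sub_distrib]
  simp only [Finset.sum_const, Finset.card_range, nsmul_eq_mul] at h4
  linarith

/-- The lower bound for the energy of points which are spread along an interval of length `ℓ`. -/
theorem partialZeta_mul_le_energy (hs : 0 < s) (κ : ℕ)
    (ω : Finset (EuclideanSpace ℝ (Fin d))) (g : EuclideanSpace ℝ (Fin d) → ℝ) {a ℓ : ℝ}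
    (hℓ : 0 < ℓ) (hg : ∀ x ∈ ω, g x ∈ Set.Icc a (a + ℓ))
    (hdist : ∀ x ∈ ω, ∀ y ∈ ω, dist x y ≤ |g x - g y|) :
    partialZeta s κ * (max ((ω.card : ℝ) - κ) 0) ^ (1 + s) / ℓ ^ s ≤ energy s ω := by
  classical
  rcases le_or_gt ω.card κ with hn | hn
  · have : max ((ω.card : ℝ) - κ) 0 = 0 := max_eq_right (by
      have : (ω.card : ℝ) ≤ κ := by exact_mod_cast hn
      linarith)
    rw [this, Real.zero_rpow (by linarith)]
    simpa using energy_nonneg ω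
  have hinj : Set.InjOn g ω := fun x hx y hy hxy => by
    have := hdist x hx y hy
    rw [hxy, sub_self, abs_zero] at this
    exact dist_le_zero.1 this
  obtain ⟨x, hxω, hmono⟩ := exists_enumeration ω g hinj
  set n := ω.card with hndef
  have hxmem : ∀ i < n, x i ∈ ω := fun i hi => by
    have : x i ∈ (Finset.range n).image x := Finset.mem_image_of_mem _ (Finset.mem_range.2 hi)
    rwa [hxω] at this
  have hxinj : Set.InjOn x (Finset.range n) :=
    Finset.card_image_iff.1 (by rw [hxω, Finset.card_range])
  have hmax : max ((n : ℝ) - κ) 0 = ((n - κ : ℕ) : ℝ) := by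
    rw [Nat.cast_sub hn.le, max_eq_left]
    have : (κ : ℝ) < n := by exact_mod_cast hn
    linarith
  -- Only pairs with index difference at most `κ` are kept; the pair `(i, i + k + 1)` is found in
  -- the row of its larger index.
  have hswap : ∑ k ∈ Finset.range κ, ∑ i ∈ Finset.range (n - (k + 1)),
      1 / dist (x (i + (k + 1))) (x i) ^ s
      ≤ ∑ i ∈ Finset.range n, ∑ k ∈ Finset.range i, 1 / dist (x i) (x (i - 1 - k)) ^ s := by
    rw [Finset.sum_sigma', Finset.sum_sigma']
    have hinj' : Set.InjOn (fun p : (_ : ℕ) × ℕ => (⟨p.2 + (p.1 + 1), p.1⟩ : (_ : ℕ) × ℕ))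
        ((Finset.range κ).sigma fun k => Finset.range (n - (k + 1))) := by
      rintro ⟨k, i⟩ _ ⟨k', i'⟩ _ h
      simp only [Sigma.mk.injEq, heq_eq_eq] at h
      obtain ⟨h1, rfl⟩ := h
      simp at h1
      simp [h1]
    refine le_trans (le_of_eq ?_) (Finset.sum_le_sum_of_subset_of_nonneg
      (s := ((Finset.range κ).sigma fun k => Finset.range (n - (k + 1))).image
        (fun p : (_ : ℕ) × ℕ => (⟨p.2 + (p.1 + 1), p.1⟩ : (_ : ℕ) × ℕ))) ?_
        (fun _ _ _ => by positivity))
    · rw [Finset.sum_image hinj']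
      refine Finset.sum_congr rfl ?_
      rintro ⟨k, i⟩ _
      have : i + (k + 1) - 1 - k = i := by omega
      simp only [this]
    · intro p hp
      obtain ⟨⟨k, i⟩, hki, rfl⟩ := Finset.mem_image.1 hp
      simp only [Finset.mem_sigma, Finset.mem_range] at hki ⊢
      omega
  -- Radon's inequality with all numerators `1`, applied to the gaps between `(k + 1)`-th
  -- neighbours, whose total is at most `(k + 1) ℓ`. There are `n - (k + 1) ≥ n - κ` of them.
  have hrow : ∀ k ∈ Finset.range κ,
      1 / ((k : ℝ) + 1) ^ s * (((n - κ : ℕ) : ℝ) ^ (1 + s) / ℓ ^ s)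
        ≤ ∑ i ∈ Finset.range (n - (k + 1)), 1 / dist (x (i + (k + 1))) (x i) ^ s := by
    intro k hk
    have hk' := Finset.mem_range.1 hk
    have hpos : ∀ i ∈ Finset.range (n - (k + 1)), 0 < g (x (i + (k + 1))) - g (x i) := by
      intro i hi
      have := Finset.mem_range.1 hi
      exact sub_pos.2 (hmono _ _ (by omega) (by omega))
    have hsum : ∑ i ∈ Finset.range (n - (k + 1)), (g (x (i + (k + 1))) - g (x i))
        ≤ ((k : ℝ) + 1) * ℓ := by
      have := sum_shift_sub_le (v := fun i => g (x i) - a) (ℓ := ℓ) (n := n) (m := k + 1)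
        (by omega) (fun i hi => by
          have := hg _ (hxmem i hi)
          exact ⟨by linarith [this.1], by linarith [this.2]⟩)
      simpa using this
    have hsum0 : 0 < ∑ i ∈ Finset.range (n - (k + 1)), (g (x (i + (k + 1))) - g (x i)) :=
      Finset.sum_pos hpos (by simp; omega)
    have hR := radon_inequality (Finset.range (n - (k + 1))) (fun _ => (1 : ℝ))
      (fun i => g (x (i + (k + 1))) - g (x i)) hs (fun _ _ => zero_le_one) hpos
    calc 1 / ((k : ℝ) + 1) ^ s * (((n - κ : ℕ) : ℝ) ^ (1 + s) / ℓ ^ s)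
        = ((n - κ : ℕ) : ℝ) ^ (1 + s) / (((k : ℝ) + 1) * ℓ) ^ s := by
          rw [Real.mul_rpow (by positivity) hℓ.le]
          field_simp
      _ ≤ ((n - (k + 1) : ℕ) : ℝ) ^ (1 + s) /
          (∑ i ∈ Finset.range (n - (k + 1)), (g (x (i + (k + 1))) - g (x i))) ^ s := by
          gcongr
          omega
      _ ≤ _ := by simpa using hR
      _ ≤ _ := by
          refine Finset.sum_le_sum fun i hi => ?_
          have hi' := Finset.mem_range.1 hi
          have hd := hdist _ (hxmem (i + (k + 1)) (by omega)) _ (hxmem i (by omega))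
          rw [abs_of_pos (hpos i hi)] at hd
          have hd0 : 0 < dist (x (i + (k + 1))) (x i) := dist_pos.2 fun h => by
            have := hpos i hi
            rw [h, sub_self] at this
            exact this.false
          rw [← one_div]
          gcongr
  calc partialZeta s κ * (max ((n : ℝ) - κ) 0) ^ (1 + s) / ℓ ^ s
      = 2 * ∑ k ∈ Finset.range κ, 1 / ((k : ℝ) + 1) ^ s *
          (((n - κ : ℕ) : ℝ) ^ (1 + s) / ℓ ^ s) := by
        rw [hmax, partialZeta, ← Finset.sum_mul]; ring
    _ ≤ 2 * ∑ i ∈ Finset.range n, ∑ k ∈ Finset.range i,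
          1 / dist (x i) (x (i - 1 - k)) ^ s := by
        have := (Finset.sum_le_sum hrow).trans hswap
        linarith
    _ = energy s ω := by rw [← energy_image_range hxinj, hxω]

theorem zeta_facts (hs : 1 < s) :
    (∀ κ, partialZeta s κ ≤ 2 * (riemannZeta (s : ℂ)).re) ∧
      Tendsto (partialZeta s) atTop (𝓝 (2 * (riemannZeta (s : ℂ)).re)) := by
  have hsum : Summable fun n : ℕ => 1 / ((n : ℝ) + 1) ^ s := by
    have := (summable_nat_add_iff 1).2 (Real.summable_one_div_nat_rpow.2 hs)
    simpa using this
  have hz : (riemannZeta (s : ℂ)).re = ∑' n : ℕ, 1 / ((n : ℝ) + 1) ^ s := by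
    rw [zeta_eq_tsum_one_div_nat_add_one_cpow (by simpa using hs)]
    have : ∀ n : ℕ, 1 / ((n : ℂ) + 1) ^ (s : ℂ) = ((1 / ((n : ℝ) + 1) ^ s : ℝ) : ℂ) := by
      intro n
      rw [Complex.ofReal_div, Complex.ofReal_cpow (by positivity)]
      simp
    simp only [this]
    rw [← Complex.ofReal_tsum, Complex.ofReal_re]
  constructor
  · intro κ
    rw [hz, partialZeta]
    gcongr
    exact hsum.sum_le_tsum _ fun _ _ => by positivity
  · rw [hz]
    exact hsum.hasSum.tendsto_sum_nat.const_mul 2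

/-- `S` carries a real coordinate that is `1`-Lipschitz and expands distances by at most the
factor `1 + ε` on the way back. -/
def IsNearlyLinear {E : Type*} [MetricSpace E] (ε : ℝ) (S : Set E) : Prop :=
  ∃ g : E → ℝ, LipschitzWith 1 g ∧ ∀ x ∈ S, ∀ y ∈ S, dist x y ≤ (1 + ε) * |g x - g y|

/-- `f` changes distances on `s` by at most the factor `L`. -/
def BiLipschitzBound {X Y : Type*} [MetricSpace X] [MetricSpace Y]
    (L : ℝ) (f : X → Y) (s : Set X) : Prop :=
  ∀ x ∈ s, ∀ y ∈ s, dist x y ≤ L * dist (f x) (f y) ∧ dist (f x) (f y) ≤ L * dist x y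

end Energy

/-! ### Nearly linear sets and bi-Lipschitz maps -/

section Metric

variable {E : Type*} [MetricSpace E]

theorem IsNearlyLinear.mono {ε : ℝ} {S T : Set E} (hT : IsNearlyLinear ε T) (h : S ⊆ T) :
    IsNearlyLinear ε S := by
  obtain ⟨g, hg, hg'⟩ := hT
  exact ⟨g, hg, fun x hx y hy => hg' x (h hx) y (h hy)⟩

theorem IsNearlyLinear.closure {ε : ℝ} {S : Set E} (hS : IsNearlyLinear ε S) :
    IsNearlyLinear ε (closure S) := by
  obtain ⟨g, hg, hg'⟩ := hS
  refine ⟨g, hg, fun x hx y hy => ?_⟩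
  have hgc := hg.continuous
  have hcl : IsClosed {p : E × E | dist p.1 p.2 ≤ (1 + ε) * |g p.1 - g p.2|} :=
    isClosed_le (by fun_prop) (by fun_prop)
  have hsub : S ×ˢ S ⊆ {p : E × E | dist p.1 p.2 ≤ (1 + ε) * |g p.1 - g p.2|} :=
    fun p hp => hg' p.1 hp.1 p.2 hp.2
  have hmem : (x, y) ∈ _root_.closure (S ×ˢ S) := by
    rw [closure_prod_eq]; exact ⟨hx, hy⟩
  exact closure_minimal hsub hcl hmem

variable {L : ℝ} {f : ℝ → E} {s : Set ℝ}

theorem BiLipschitzBound.mono {t : Set ℝ} (h : BiLipschitzBound L f s) (hts : t ⊆ s) :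
    BiLipschitzBound L f t := fun x hx y hy => h x (hts hx) y (hts hy)

theorem BiLipschitzBound.injOn (h : BiLipschitzBound L f s) : Set.InjOn f s := by
  intro x hx y hy hxy
  have := (h x hx y hy).1
  rw [hxy, dist_self, mul_zero] at this
  exact dist_le_zero.1 this

theorem BiLipschitzBound.lipschitzOnWith (h : BiLipschitzBound L f s) :
    LipschitzOnWith L.toNNReal f s :=
  LipschitzOnWith.of_dist_le_mul fun x hx y hy =>
    (h x hx y hy).2.trans (by gcongr; exact Real.le_coe_toNNReal L)

theorem BiLipschitzBound.lipschitzOnWith_invFunOn (h : BiLipschitzBound L f s) :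
    LipschitzOnWith L.toNNReal (Function.invFunOn f s) (f '' s) := by
  refine LipschitzOnWith.of_dist_le_mul ?_
  rintro _ ⟨x, hx, rfl⟩ _ ⟨y, hy, rfl⟩
  rw [h.injOn.leftInvOn_invFunOn hx, h.injOn.leftInvOn_invFunOn hy]
  exact (h x hx y hy).1.trans (by gcongr; exact Real.le_coe_toNNReal L)

variable [MeasurableSpace E] [BorelSpace E]

theorem BiLipschitzBound.hausdorffMeasure_image_le (h : BiLipschitzBound L f s) :
    μH[1] (f '' s) ≤ ENNReal.ofReal L * volume s := by
  have := h.lipschitzOnWith.hausdorffMeasure_image_le zero_le_one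
  rw [ENNReal.rpow_one, hausdorffMeasure_real] at this
  exact this

theorem BiLipschitzBound.volume_le (h : BiLipschitzBound L f s) :
    volume s ≤ ENNReal.ofReal L * μH[1] (f '' s) := by
  have := h.lipschitzOnWith_invFunOn.hausdorffMeasure_image_le zero_le_one
  rw [ENNReal.rpow_one, hausdorffMeasure_real, h.injOn.invFunOn_image subset_rfl] at this
  exact this

end Metric

/-! ### Almost everywhere differentiability and nearly linear covers -/

section Normed

variable {E : Type*} [NormedAddCommGroup E] [NormedSpace ℝ E]

/-- On `s` the map `f` scales all distances by a factor between `‖A 1‖ - δ` and `‖A 1‖ + δ`. The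
lower bi-Lipschitz bound keeps `‖A 1‖` away from `0`, so for small `δ` these two factors have ratio
at most `1 + ε`. The coordinate is the inverse of `f` times the smaller factor, extended to all of
`E` with the same Lipschitz constant. -/
theorem isNearlyLinear_image_of_approximatesLinearOn {L ε : ℝ} (hL : 0 < L) (hε : 0 < ε)
    {f : ℝ → E} {s : Set ℝ} (hf : BiLipschitzBound L f s) {A : ℝ →L[ℝ] E} {δ : NNReal}
    (hA : ApproximatesLinearOn f A s δ) (hδ : 2 * (δ : ℝ) * (1 + ε) < ε / L) :
    IsNearlyLinear ε (f '' s) := by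
  rcases s.subsingleton_or_nontrivial with hs | ⟨x₀, hx₀, y₀, hy₀, hne⟩
  · refine ⟨fun _ => 0, LipschitzWith.const' 0, fun x hx y hy => ?_⟩
    rw [hs.image f hx hy]
    simp
  have hAn : ∀ r : ℝ, ‖A r‖ = ‖A 1‖ * |r| := by
    intro r
    have : A r = r • A 1 := by rw [← map_smul, smul_eq_mul, mul_one]
    rw [this, norm_smul, Real.norm_eq_abs, mul_comm]
  have hup : ∀ x ∈ s, ∀ y ∈ s, dist (f x) (f y) ≤ (‖A 1‖ + δ) * |x - y| := by
    intro x hx y hy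
    have h1 := hA x hx y hy
    have h2 := norm_le_norm_add_norm_sub (A (x - y)) (f x - f y)
    rw [hAn] at h2
    rw [Real.norm_eq_abs] at h1
    rw [norm_sub_rev (A (x - y))] at h2
    rw [dist_eq_norm]; linarith
  have hlow : ∀ x ∈ s, ∀ y ∈ s, (‖A 1‖ - δ) * |x - y| ≤ dist (f x) (f y) := by
    intro x hx y hy
    have h1 := hA x hx y hy
    have h2 := norm_le_norm_add_norm_sub (f x - f y) (A (x - y))
    rw [hAn] at h2
    rw [Real.norm_eq_abs] at h1
    rw [dist_eq_norm]; linarith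
  have ha : 1 / L ≤ ‖A 1‖ + δ := by
    have h1 := (hf x₀ hx₀ y₀ hy₀).1
    have h2 := hup x₀ hx₀ y₀ hy₀
    have h3 : 0 < |x₀ - y₀| := abs_pos.2 (sub_ne_zero.2 hne)
    rw [Real.dist_eq] at h1
    rw [div_le_iff₀ hL]
    have : |x₀ - y₀| ≤ (L * (‖A 1‖ + δ)) * |x₀ - y₀| := by
      rw [mul_assoc]; exact h1.trans (by gcongr)
    nlinarith
  have hδ0 : (0 : ℝ) ≤ δ := δ.2
  -- The difference of the two sides is `ε (‖A 1‖ + δ) - 2 δ (1 + ε)`, which is positive by `ha` and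
  -- `hδ`.
  have hratio : ‖A 1‖ + δ ≤ (1 + ε) * (‖A 1‖ - δ) := by
    have : ε / L = ε * (1 / L) := by ring
    nlinarith
  have hlam : 0 < ‖A 1‖ - δ := by
    have : 0 < ‖A 1‖ + δ := (by positivity : 0 < 1 / L).trans_le ha
    by_contra h
    nlinarith
  set lam := ‖A 1‖ - δ with hlamdef
  have hLip : LipschitzOnWith 1 (fun y => lam * Function.invFunOn f s y) (f '' s) := by
    refine LipschitzOnWith.of_dist_le_mul ?_
    rintro _ ⟨x, hx, rfl⟩ _ ⟨y, hy, rfl⟩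
    simp only [hf.injOn.leftInvOn_invFunOn hx, hf.injOn.leftInvOn_invFunOn hy]
    rw [Real.dist_eq, ← mul_sub, abs_mul, abs_of_pos hlam, NNReal.coe_one, one_mul]
    exact hlow x hx y hy
  obtain ⟨g, hg, hgeq⟩ := hLip.extend_real
  refine ⟨g, hg, ?_⟩
  rintro _ ⟨x, hx, rfl⟩ _ ⟨y, hy, rfl⟩
  rw [← hgeq ⟨x, hx, rfl⟩, ← hgeq ⟨y, hy, rfl⟩]
  simp only [hf.injOn.leftInvOn_invFunOn hx, hf.injOn.leftInvOn_invFunOn hy]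
  rw [← mul_sub, abs_mul, abs_of_pos hlam, ← mul_assoc]
  exact (hup x hx y hy).trans (by gcongr)

variable [FiniteDimensional ℝ E] [MeasurableSpace E] [BorelSpace E]

/-- A Lipschitz function of a real variable has locally bounded variation, hence is differentiable
almost everywhere. The differentiability set splits into countably many parts on which `f` is close
to linear, and the exceptional parameters have a null image. Closures are taken to make the covering
sets measurable. -/
theorem exists_countable_isNearlyLinear_cover_image {L ε : ℝ} (hL : 0 < L) (hε : 0 < ε)
    {f : ℝ → E} {s : Set ℝ} (hf : BiLipschitzBound L f s) :
    ∃ 𝒮 : Set (Set E), 𝒮.Countable ∧ (∀ S ∈ 𝒮, IsClosed S ∧ IsNearlyLinear ε S) ∧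
      μH[1] (f '' s \ ⋃₀ 𝒮) = 0 := by
  set D := {x ∈ s | DifferentiableWithinAt ℝ f s x} with hD
  have hDs : D ⊆ s := fun x hx => hx.1
  have hderiv : ∀ x ∈ D, HasFDerivWithinAt f (fderivWithin ℝ f s x) D x := fun x hx =>
    hx.2.hasFDerivWithinAt.mono hDs
  obtain ⟨δ, hδ, hδ'⟩ : ∃ δ : NNReal, δ ≠ 0 ∧ 2 * (δ : ℝ) * (1 + ε) < ε / L := by
    have hpos : 0 < ε / (4 * L * (1 + ε)) := by positivity
    refine ⟨(ε / (4 * L * (1 + ε))).toNNReal, (Real.toNNReal_pos.2 hpos).ne', ?_⟩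
    have h1 : 2 * (ε / (4 * L * (1 + ε))) * (1 + ε) = ε / L / 2 := by
      field_simp; norm_num
    have h2 : 0 < ε / L := by positivity
    rw [Real.coe_toNNReal _ hpos.le, h1]
    linarith
  obtain ⟨t, A, -, hDt, happ, -⟩ := exists_closed_cover_approximatesLinearOn_of_hasFDerivWithinAt
    f D (fderivWithin ℝ f s) hderiv (fun _ => δ) (fun _ => hδ)
  refine ⟨Set.range fun n => closure (f '' (D ∩ t n)), Set.countable_range _, ?_, ?_⟩
  · rintro _ ⟨n, rfl⟩
    exact ⟨isClosed_closure, (isNearlyLinear_image_of_approximatesLinearOn hL hε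
      (hf.mono (Set.inter_subset_left.trans hDs)) (happ n) hδ').closure⟩
  · have hsub : f '' s \ ⋃₀ Set.range (fun n => closure (f '' (D ∩ t n))) ⊆ f '' (s \ D) := by
      rintro _ ⟨⟨x, hx, rfl⟩, hx'⟩
      refine ⟨x, ⟨hx, fun hxD => hx' ?_⟩, rfl⟩
      obtain ⟨n, hn⟩ := Set.mem_iUnion.1 (hDt hxD)
      exact ⟨_, ⟨n, rfl⟩, subset_closure ⟨x, ⟨hxD, hn⟩, rfl⟩⟩
    have hnull : volume (s \ D) = 0 := by
      have h := hf.lipschitzOnWith.locallyBoundedVariationOn.ae_differentiableWithinAt_of_mem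
      rw [ae_iff] at h
      refine measure_mono_null ?_ h
      rintro x ⟨hx, hxD⟩ h'
      exact hxD ⟨hx, h' hx⟩
    refine measure_mono_null hsub ?_
    have := (hf.mono (Set.sdiff_subset (s := s) (t := D))).hausdorffMeasure_image_le
    rwa [hnull, mul_zero, nonpos_iff_eq_zero] at this

end Normed

/-! ### Decomposition of rectifiable sets -/

section Rectifiable

variable {d : ℕ}

/-- Each compact parameter set is cut down to the preimage of `A`, which stays compact because the
chart is continuous. The line replaces `EuclideanSpace ℝ (Fin 1)`, and one constant serves all
charts. -/
theorem IsRectifiableManifold.exists_biLipschitzBound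
    {M A : Set (EuclideanSpace ℝ (Fin d))} (hM : IsRectifiableManifold 1 M) (hAM : A ⊆ M)
    (hA : IsCompact A) :
    ∃ (n : ℕ) (L : ℝ) (C : Fin n → Set ℝ) (f : Fin n → ℝ → EuclideanSpace ℝ (Fin d)),
      0 < L ∧ (∀ k, IsCompact (C k) ∧ BiLipschitzBound L (f k) (C k)) ∧
        A = ⋃ k, f k '' C k := by
  obtain ⟨n, K, G, φ, hφ, rfl⟩ := hM
  choose hK hG hKG hbi using hφ
  choose L hL hbi using hbi
  let e : ℝ ≃ᵢ EuclideanSpace ℝ (Fin 1) :=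
    (LinearIsometryEquiv.toIsometryEquiv (OrthonormalBasis.singleton (Fin 1) ℝ).repr)
  have hB : ∀ k, BiLipschitzBound (L k) (φ k) (K k) := by
    intro k x hx y hy
    obtain ⟨h1, h2⟩ := hbi k x (hKG k hx) y (hKG k hy)
    refine ⟨?_, h2⟩
    rwa [one_div, inv_mul_le_iff₀ (hL k)] at h1
  have hφc : ∀ k, ContinuousOn (φ k) (K k) := fun k =>
    (LipschitzOnWith.of_dist_le_mul (K := (L k).toNNReal) fun x hx y hy =>
      (hB k x hx y hy).2.trans (by gcongr; exact Real.le_coe_toNNReal _)).continuousOn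
  have hcpt : ∀ k, IsCompact (K k ∩ φ k ⁻¹' A) := fun k =>
    (hK k).of_isClosed_subset ((hφc k).preimage_isClosed_of_isClosed (hK k).isClosed hA.isClosed)
      Set.inter_subset_left
  have hLle : ∀ k, L k ≤ 1 + ∑ j, L j := fun k => by
    have := Finset.single_le_sum (f := L) (fun j _ => (hL j).le) (Finset.mem_univ k)
    linarith
  have hpos : 0 < 1 + ∑ k, L k := by
    have := Finset.sum_nonneg fun k (_ : k ∈ Finset.univ) => (hL k).le
    linarith
  refine ⟨n, 1 + ∑ k, L k, fun k => e ⁻¹' (K k ∩ φ k ⁻¹' A), fun k => φ k ∘ e, hpos,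
    fun k => ⟨?_, ?_⟩, ?_⟩
  · rw [← e.image_symm]
    exact (hcpt k).image e.symm.continuous
  · intro x hx y hy
    obtain ⟨h1, h2⟩ := hB k (e x) hx.1 (e y) hy.1
    rw [e.dist_eq] at h1 h2
    exact ⟨h1.trans (mul_le_mul_of_nonneg_right (hLle k) dist_nonneg),
      h2.trans (mul_le_mul_of_nonneg_right (hLle k) dist_nonneg)⟩
  · have : ∀ k, (φ k ∘ e) '' (e ⁻¹' (K k ∩ φ k ⁻¹' A)) = φ k '' K k ∩ A := by
      intro k
      rw [Set.image_comp, Set.image_preimage_eq _ e.surjective, Set.image_inter_preimage]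
    simp only [this]
    rw [← Set.iUnion_inter, Set.inter_eq_right.2 hAM]

/-- The countable cover is made disjoint, finitely many parts exhaust `A` up to measure `η / 2`, and
inner regularity replaces each of these by a compact subset, losing at most `η / 2` altogether. -/
theorem exists_disjoint_isNearlyLinear {A : Set (EuclideanSpace ℝ (Fin d))} (hA : IsCompact A)
    (hfin : μH[1] A ≠ ∞) {n : ℕ} {L : ℝ} (hL : 0 < L) {C : Fin n → Set ℝ}
    {f : Fin n → ℝ → EuclideanSpace ℝ (Fin d)} (hf : ∀ k, BiLipschitzBound L (f k) (C k))
    (hAC : A = ⋃ k, f k '' C k) {ε : ℝ} (hε : 0 < ε) {η : ℝ≥0∞} (hη : η ≠ 0) :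
    ∃ (N : ℕ) (Q : ℕ → Set (EuclideanSpace ℝ (Fin d))),
      (∀ j, IsCompact (Q j) ∧ IsNearlyLinear ε (Q j) ∧ Q j ⊆ A) ∧
      Pairwise (Function.onFun Disjoint Q) ∧ μH[1] (A \ ⋃ j ∈ Finset.range N, Q j) ≤ η := by
  choose 𝒮 hcount h𝒮 hnull using fun k => exists_countable_isNearlyLinear_cover_image hL hε (hf k)
  -- The empty set is added so that the family is nonempty and can be enumerated.
  obtain ⟨S, hS⟩ := (Set.Countable.insert ∅ (Set.countable_iUnion hcount)).exists_eq_range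
    ⟨∅, Set.mem_insert _ _⟩
  have hSj : ∀ j, IsClosed (S j) ∧ IsNearlyLinear ε (S j) := by
    intro j
    have : S j ∈ insert ∅ (⋃ k, 𝒮 k) := hS ▸ Set.mem_range_self j
    rcases this with h | h
    · rw [h]
      exact ⟨isClosed_empty, fun _ => 0, LipschitzWith.const' 0, by simp⟩
    · obtain ⟨k, hk⟩ := Set.mem_iUnion.1 h
      exact h𝒮 k _ hk
  have hcover : μH[1] (A \ ⋃ j, S j) = 0 := by
    refine measure_mono_null (t := ⋃ k, (f k '' C k \ ⋃₀ 𝒮 k)) ?_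
      (measure_iUnion_null_iff.2 hnull)
    rintro x ⟨hxA, hxS⟩
    rw [hAC] at hxA
    obtain ⟨k, hk⟩ := Set.mem_iUnion.1 hxA
    refine Set.mem_iUnion.2 ⟨k, hk, ?_⟩
    rintro ⟨T, hT, hxT⟩
    have : T ∈ Set.range S := hS ▸ Or.inr (Set.mem_iUnion.2 ⟨k, hT⟩)
    obtain ⟨j, rfl⟩ := this
    exact hxS (Set.mem_iUnion.2 ⟨j, hxT⟩)
  set μ := (μH[1] : Measure (EuclideanSpace ℝ (Fin d))).restrict A with hμ
  have hμfin : IsFiniteMeasure μ := ⟨by rw [hμ, Measure.restrict_apply_univ]; exact hfin.lt_top⟩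
  set D := fun j => A ∩ disjointed S j with hD
  have hDm : ∀ j, MeasurableSet (D j) := fun j =>
    hA.measurableSet.inter (MeasurableSet.disjointed (fun i => (hSj i).1.measurableSet) j)
  have hDdisj : Pairwise (Function.onFun Disjoint D) := fun i j hij =>
    (disjoint_disjointed S hij).mono Set.inter_subset_right Set.inter_subset_right
  have hη2 : η / 2 ≠ 0 := by simpa using hη
  obtain ⟨N, hN⟩ : ∃ N, μH[1] (A \ ⋃ j ∈ Finset.range N, D j) ≤ η / 2 := by
    have hanti : Antitone fun N => A \ ⋃ j ∈ Finset.range N, D j := fun a b hab =>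
      Set.sdiff_subset_sdiff_right
        (Set.biUnion_subset_biUnion_left (by simpa using Finset.range_mono hab))
    have hlim := tendsto_measure_iInter_atTop (μ := μH[1])
      (s := fun N => A \ ⋃ j ∈ Finset.range N, D j)
      (fun N => (hA.measurableSet.diff
        (Finset.measurableSet_biUnion _ fun j _ => hDm j)).nullMeasurableSet) hanti
      ⟨0, ne_top_of_le_ne_top hfin (measure_mono Set.sdiff_subset)⟩
    have h0 : μH[1] (⋂ N, A \ ⋃ j ∈ Finset.range N, D j) = 0 := by
      refine measure_mono_null ?_ hcover
      intro x hx
      have hxA : x ∈ A := (Set.mem_iInter.1 hx 0).1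
      refine ⟨hxA, fun hxS => ?_⟩
      rw [← iUnion_disjointed] at hxS
      obtain ⟨j, hj⟩ := Set.mem_iUnion.1 hxS
      refine (Set.mem_iInter.1 hx (j + 1)).2 ?_
      exact Set.mem_biUnion (x := j) (by simp) ⟨hxA, hj⟩
    rw [h0] at hlim
    exact ((tendsto_order.1 hlim).2 _ (pos_iff_ne_zero.2 hη2)).exists.imp fun _ h => h.le
  have hηN : η / 2 / (N + 1) ≠ 0 := ENNReal.div_ne_zero.2 ⟨hη2,
    ENNReal.add_ne_top.2 ⟨ENNReal.natCast_ne_top N, ENNReal.one_ne_top⟩⟩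
  have hQ : ∀ j, ∃ Q ⊆ D j, IsCompact Q ∧ μ (D j \ Q) < η / 2 / (N + 1) := fun j =>
    (hDm j).exists_isCompact_sdiff_lt (measure_ne_top μ _) hηN
  choose Q hQD hQc hQμ using hQ
  refine ⟨N, Q, fun j => ⟨hQc j, ?_, (hQD j).trans Set.inter_subset_left⟩,
    fun i j hij => (hDdisj hij).mono (hQD i) (hQD j), ?_⟩
  · exact (hSj j).2.mono ((hQD j).trans (Set.inter_subset_right.trans (disjointed_subset S j)))
  have hsub : A \ ⋃ j ∈ Finset.range N, Q j ⊆
      (A \ ⋃ j ∈ Finset.range N, D j) ∪ ⋃ j ∈ Finset.range N, (D j \ Q j) := by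
    rintro x ⟨hxA, hxQ⟩
    by_cases hx : x ∈ ⋃ j ∈ Finset.range N, D j
    · right
      simp only [Set.mem_iUnion] at hx hxQ ⊢
      obtain ⟨j, hj, hxj⟩ := hx
      exact ⟨j, hj, hxj, fun h => hxQ ⟨j, hj, h⟩⟩
    · exact Or.inl ⟨hxA, hx⟩
  have hDQ : ∀ j, μH[1] (D j \ Q j) ≤ η / 2 / (N + 1) := by
    intro j
    have h := (hQμ j).le
    rwa [hμ, Measure.restrict_eq_self _ (Set.sdiff_subset.trans Set.inter_subset_left)] at h
  calc μH[1] (A \ ⋃ j ∈ Finset.range N, Q j)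
      ≤ η / 2 + ∑ j ∈ Finset.range N, η / 2 / (N + 1) :=
        (measure_mono hsub).trans ((measure_union_le _ _).trans (add_le_add hN
          ((measure_biUnion_finset_le _ _).trans (Finset.sum_le_sum fun j _ => hDQ j))))
    _ ≤ η / 2 + (N + 1) * (η / 2 / (N + 1)) := by
        rw [Finset.sum_const, Finset.card_range, nsmul_eq_mul]
        gcongr
        exact le_self_add
    _ ≤ η := by
        refine (add_le_add_right ENNReal.mul_div_le _).trans ?_
        rw [ENNReal.add_halves]

end Rectifiable

/-! ### Energy lower bounds on nearly linear pieces -/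

variable {d : ℕ} {s : ℝ}

/-- The energy of `n` points of `S` is at least that of `n` points of an interval of length `ℓ`,
up to a bounded number of points and the truncation of the zeta function. -/
def HasEnergyLowerBound (s : ℝ) (κ : ℕ) (S : Set (EuclideanSpace ℝ (Fin d))) (ℓ : ℝ) : Prop :=
  ∃ C : ℝ, ∀ ω : Finset (EuclideanSpace ℝ (Fin d)), (ω : Set _) ⊆ S →
    partialZeta s κ * ((max ((ω.card : ℝ) - C) 0) ^ (1 + s) / ℓ ^ s) ≤ energy s ω

theorem HasEnergyLowerBound.mono (hs : 0 < s) {κ : ℕ} {S T : Set (EuclideanSpace ℝ (Fin d))}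
    {ℓ ℓ' : ℝ} (h : HasEnergyLowerBound s κ T ℓ) (hST : S ⊆ T) (hℓ : 0 < ℓ) (hℓ' : ℓ ≤ ℓ') :
    HasEnergyLowerBound s κ S ℓ' := by
  obtain ⟨C, hC⟩ := h
  refine ⟨C, fun ω hω => le_trans ?_ (hC ω (hω.trans hST))⟩
  have := partialZeta_nonneg (s := s) κ
  gcongr

/-- The interaction between the two parts of a configuration is discarded, and Radon's inequality
bounds the sum of the two remaining terms for every way of distributing the points. -/
theorem HasEnergyLowerBound.union (hs : 0 < s) {κ : ℕ} {S T : Set (EuclideanSpace ℝ (Fin d))}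
    {ℓ ℓ' : ℝ} (hS : HasEnergyLowerBound s κ S ℓ) (hT : HasEnergyLowerBound s κ T ℓ')
    (hℓ : 0 < ℓ) (hℓ' : 0 < ℓ') : HasEnergyLowerBound s κ (S ∪ T) (ℓ + ℓ') := by
  classical
  obtain ⟨C, hC⟩ := hS
  obtain ⟨C', hC'⟩ := hT
  refine ⟨C + C', fun ω hω => ?_⟩
  have h1 := hC (ω.filter (· ∈ S)) (by intro x hx; simpa using (Finset.mem_filter.1 hx).2)
  have h2 := hC' (ω.filter (· ∉ S)) (by
    intro x hx
    obtain ⟨hx, hxS⟩ := Finset.mem_filter.1 hx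
    exact (hω hx).resolve_left hxS)
  have h3 := energy_add_le_energy_union (s := s)
    (Finset.disjoint_filter_filter_not ω ω (· ∈ S))
  rw [Finset.filter_union_filter_not_eq] at h3
  have hcard : ((ω.filter (· ∈ S)).card : ℝ) + ((ω.filter (· ∉ S)).card : ℝ) = ω.card := by
    exact_mod_cast Finset.card_filter_add_card_filter_not (s := ω) (· ∈ S)
  refine le_trans ?_ ((add_le_add h1 h2).trans h3)
  rw [← mul_add]
  refine mul_le_mul_of_nonneg_left ?_ (partialZeta_nonneg κ)
  refine le_trans ?_ (radon_inequality_two hs (le_max_right _ _) (le_max_right _ _) hℓ hℓ')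
  gcongr
  refine max_le ?_ (add_nonneg (le_max_right _ _) (le_max_right _ _))
  have := le_max_left (((ω.filter (· ∈ S)).card : ℝ) - C) 0
  have := le_max_left (((ω.filter (· ∉ S)).card : ℝ) - C') 0
  linarith

theorem hasEnergyLowerBound_empty (κ : ℕ) (hs : 0 < s) (ℓ : ℝ) :
    HasEnergyLowerBound s κ (∅ : Set (EuclideanSpace ℝ (Fin d))) ℓ := by
  refine ⟨0, fun ω hω => ?_⟩
  have : ω = ∅ := by simpa using hω
  subst this
  have h : 1 + s ≠ 0 := by linarith
  simp [Real.zero_rpow h, energy]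

/-- The extra `δ` keeps the length positive for the empty union, from which the induction starts. -/
theorem HasEnergyLowerBound.biUnion (hs : 0 < s) {κ : ℕ} {ι : Type*} (I : Finset ι)
    {S : ι → Set (EuclideanSpace ℝ (Fin d))} {ℓ : ι → ℝ} (hℓ : ∀ i ∈ I, 0 < ℓ i) {δ : ℝ}
    (hδ : 0 < δ) (h : ∀ i ∈ I, HasEnergyLowerBound s κ (S i) (ℓ i)) :
    HasEnergyLowerBound s κ (⋃ i ∈ I, S i) (∑ i ∈ I, ℓ i + δ) := by
  classical
  induction I using Finset.induction_on with
  | empty => simpa using hasEnergyLowerBound_empty κ hs δ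
  | insert i I hi ih =>
    rw [Finset.sum_insert hi, Finset.set_biUnion_insert, add_assoc]
    have hℓI : ∀ j ∈ I, 0 < ℓ j := fun j hj => hℓ j (Finset.mem_insert_of_mem hj)
    exact (h i (Finset.mem_insert_self i I)).union hs
      (ih hℓI fun j hj => h j (Finset.mem_insert_of_mem hj))
      (hℓ i (Finset.mem_insert_self i I))
      (add_pos_of_nonneg_of_pos (Finset.sum_nonneg fun j hj => (hℓI j hj).le) hδ)

/-- A compact set of reals is covered by finitely many intervals of total length close to its
measure. -/
theorem exists_finset_intervals_cover {T : Set ℝ} (hT : IsCompact T) {δ : ℝ} (hδ : 0 < δ) :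
    ∃ (I : Finset (ℝ × ℝ)), (∀ p ∈ I, p.1 < p.2) ∧ T ⊆ ⋃ p ∈ I, Set.Icc p.1 p.2 ∧
      ∑ p ∈ I, (p.2 - p.1) ≤ (volume T).toReal + δ := by
  classical
  have hVT : volume T ≠ ∞ := hT.measure_lt_top.ne
  have hlim := tendsto_measure_cthickening_of_isCompact (μ := volume) hT
  have hev : ∀ᶠ r in 𝓝 (0 : ℝ), volume (Metric.cthickening r T) < volume T + ENNReal.ofReal δ :=
    (tendsto_order.1 hlim).2 _ (ENNReal.lt_add_right hVT (by simpa using hδ))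
  obtain ⟨ρ, hρ, hρ'⟩ := Metric.eventually_nhds_iff.1 hev
  set h := ρ / 2 with hh
  have hpos : 0 < h := by positivity
  -- The intervals are the cells of the grid of mesh `h` that meet `T`. They lie in the closed
  -- `h`-neighbourhood of `T`, whose measure is close to that of `T`.
  have hfinite : ((fun t : ℝ => ⌊t / h⌋) '' T).Finite := by
    obtain ⟨R, hR⟩ := hT.isBounded.subset_closedBall 0
    refine (Set.finite_Icc ⌊-R / h⌋ ⌊R / h⌋).subset ?_
    rintro _ ⟨t, ht, rfl⟩
    have := hR ht
    rw [Metric.mem_closedBall, dist_zero_right, Real.norm_eq_abs, abs_le] at this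
    exact ⟨Int.floor_mono (by gcongr; exact this.1), Int.floor_mono (by gcongr; exact this.2)⟩
  have hmem : ∀ t : ℝ, t ∈ Set.Ico ((⌊t / h⌋ : ℝ) * h) (⌊t / h⌋ * h + h) := fun t => by
    have h1 := Int.floor_le (t / h)
    have h2 := Int.lt_floor_add_one (t / h)
    rw [le_div_iff₀ hpos] at h1
    rw [div_lt_iff₀ hpos] at h2
    exact ⟨h1, by linarith⟩
  have hdisj : (hfinite.toFinset : Set ℤ).PairwiseDisjoint
      fun i : ℤ => Set.Ico ((i : ℝ) * h) (i * h + h) := by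
    intro i _ j _ hij
    rw [Function.onFun, Set.disjoint_left]
    rintro t ⟨h1, h2⟩ ⟨h3, h4⟩
    refine hij (le_antisymm ?_ ?_)
    · have : (i : ℝ) < j + 1 := by nlinarith
      exact Int.lt_add_one_iff.1 (by exact_mod_cast this)
    · have : (j : ℝ) < i + 1 := by nlinarith
      exact Int.lt_add_one_iff.1 (by exact_mod_cast this)
  have hsub : (⋃ i ∈ hfinite.toFinset, Set.Ico ((i : ℝ) * h) (i * h + h))
      ⊆ Metric.cthickening h T := by
    refine Set.iUnion₂_subset fun i hi => ?_
    obtain ⟨t, ht, rfl⟩ := (Set.Finite.mem_toFinset _).1 hi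
    intro u hu
    refine Metric.mem_cthickening_of_dist_le u t h T ht ?_
    have := hmem t
    rw [Real.dist_eq, abs_le]
    exact ⟨by linarith [hu.1, this.2], by linarith [hu.2, this.1]⟩
  have hmeas : (hfinite.toFinset.card : ℝ≥0∞) * ENNReal.ofReal h
      ≤ volume T + ENNReal.ofReal δ := by
    have h1 : volume (⋃ i ∈ hfinite.toFinset, Set.Ico ((i : ℝ) * h) (i * h + h))
        = hfinite.toFinset.card * ENNReal.ofReal h := by
      rw [measure_biUnion_finset hdisj fun _ _ => measurableSet_Ico]
      simp [Real.volume_Ico]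
    rw [← h1]
    refine (measure_mono hsub).trans (hρ' ?_).le
    rw [dist_zero_right, Real.norm_of_nonneg hpos.le]
    linarith
  have hmeas' := ENNReal.toReal_mono (by finiteness) hmeas
  rw [ENNReal.toReal_mul, ENNReal.toReal_natCast, ENNReal.toReal_ofReal hpos.le,
    ENNReal.toReal_add hVT (by finiteness), ENNReal.toReal_ofReal hδ.le] at hmeas'
  have hinj : Set.InjOn (fun i : ℤ => ((i : ℝ) * h, (i : ℝ) * h + h)) hfinite.toFinset := by
    intro i _ j _ hij
    have := (Prod.ext_iff.1 hij).1
    simpa [hpos.ne'] using this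
  refine ⟨hfinite.toFinset.image fun i : ℤ => ((i : ℝ) * h, (i : ℝ) * h + h), ?_, ?_, ?_⟩
  · intro p hp
    obtain ⟨i, _, rfl⟩ := Finset.mem_image.1 hp
    simpa using hpos
  · intro t ht
    simp only [Set.mem_iUnion]
    exact ⟨_, Finset.mem_image_of_mem _ ((Set.Finite.mem_toFinset _).2 ⟨t, ht, rfl⟩),
      Set.Ico_subset_Icc_self (hmem t)⟩
  · rw [Finset.sum_image hinj]
    simpa using hmeas'

/-- The coordinate image has length at most `μH[1] Q`. Covering it by finitely many intervals cuts
`Q` into slabs, and on each slab the one-dimensional bound applies to the coordinate multiplied by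
`1 + ε`, which dominates distances. -/
theorem hasEnergyLowerBound_of_isNearlyLinear (hs : 0 < s) (κ : ℕ) {ε δ : ℝ} (hε : 0 < ε)
    (hδ : 0 < δ) {Q : Set (EuclideanSpace ℝ (Fin d))} (hQ : IsCompact Q) (hlin : IsNearlyLinear ε Q)
    (hfin : μH[1] Q ≠ ∞) :
    HasEnergyLowerBound s κ Q ((1 + ε) * ((μH[1] Q).toReal + δ)) := by
  obtain ⟨g, hg, hg'⟩ := hlin
  obtain ⟨I, hI, hcov, hsum⟩ := exists_finset_intervals_cover (hQ.image hg.continuous)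
    (half_pos hδ)
  have hvol : (volume (g '' Q)).toReal ≤ (μH[1] Q).toReal := by
    refine ENNReal.toReal_mono hfin ?_
    have := hg.hausdorffMeasure_image_le zero_le_one Q
    simpa [hausdorffMeasure_real] using this
  have hpiece : ∀ p ∈ I, HasEnergyLowerBound s κ (Q ∩ g ⁻¹' Set.Icc p.1 p.2)
      ((1 + ε) * (p.2 - p.1)) := by
    intro p hp
    have hlen := sub_pos.2 (hI p hp)
    refine ⟨κ, fun ω hω => ?_⟩
    rw [← mul_div_assoc]
    refine partialZeta_mul_le_energy hs κ ω (fun x => (1 + ε) * g x) (a := (1 + ε) * p.1)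
      (by positivity) (fun x hx => ?_) fun x hx y hy => ?_
    · have := (hω hx).2
      have h1 : 0 ≤ 1 + ε := by linarith
      refine ⟨mul_le_mul_of_nonneg_left this.1 h1, ?_⟩
      have := mul_le_mul_of_nonneg_left this.2 h1
      linarith
    · rw [← mul_sub, abs_mul, abs_of_pos (by linarith)]
      exact hg' x (hω hx).1 y (hω hy).1
  have := HasEnergyLowerBound.biUnion hs I
    (fun p hp => mul_pos (by linarith : 0 < 1 + ε) (sub_pos.2 (hI p hp)))
    (mul_pos (by linarith : 0 < 1 + ε) (half_pos hδ)) hpiece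
  refine this.mono hs ?_ ?_ ?_
  · intro x hx
    have := hcov ⟨x, hx, rfl⟩
    simp only [Set.mem_iUnion] at this ⊢
    obtain ⟨p, hp, hxp⟩ := this
    exact ⟨p, hp, hx, hxp⟩
  · have := Finset.sum_nonneg fun p (hp : p ∈ I) =>
      mul_nonneg (by linarith : 0 ≤ 1 + ε) (sub_pos.2 (hI p hp)).le
    positivity
  · rw [← Finset.mul_sum, ← mul_add]
    exact mul_le_mul_of_nonneg_left (by linarith) (by linarith)

/-! ### Packing away from a closed set -/

/-- Separated points of a bi-Lipschitz arc that stay away from a closed set `K` are few if `K`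
fills most of the arc. -/
theorem card_mul_le_of_separated {L : ℝ} (hL : 0 < L) {f : ℝ → EuclideanSpace ℝ (Fin d)}
    {C : Set ℝ} (hC : IsCompact C) (hf : BiLipschitzBound L f C) {δ : ℝ} (hδ : 0 < δ) :
    ∃ r₀ > 0, ∀ K : Set (EuclideanSpace ℝ (Fin d)), IsClosed K → ∀ r, 0 < r → r < r₀ →
      ∀ ω : Finset (EuclideanSpace ℝ (Fin d)), (ω : Set _) ⊆ f '' C →
      (∀ x ∈ ω, ∀ y ∈ ω, x ≠ y → r ≤ dist x y) → (∀ x ∈ ω, ∀ y ∈ K, r ≤ dist x y) →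
      (ω.card : ℝ) * r ≤ L * (L * (μH[1] (f '' C \ K)).toReal + δ) := by
  classical
  have hVC : volume C ≠ ∞ := hC.measure_lt_top.ne
  have hlim := tendsto_measure_cthickening_of_isCompact (μ := volume) hC
  have hev : ∀ᶠ r in 𝓝 (0 : ℝ), volume (Metric.cthickening r C) < volume C + ENNReal.ofReal δ :=
    (tendsto_order.1 hlim).2 _ (ENNReal.lt_add_right hVC (by simpa using hδ))
  obtain ⟨ρ, hρ, hρ'⟩ := Metric.eventually_nhds_iff.1 hev
  refine ⟨2 * L * ρ, by positivity, fun K hK r hr hr0 ω hω hsep hfar => ?_⟩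
  set τ := Function.invFunOn f C with hτ
  have hτω : ∀ x ∈ ω, τ x ∈ C ∧ f (τ x) = x := fun x hx =>
    ⟨Function.invFunOn_mem (hω hx), Function.invFunOn_eq (hω hx)⟩
  -- With this radius, balls around the parameters of `r`-separated points are disjoint, and they
  -- miss the parameters of `K`. Together with `T` they fit into a thin neighbourhood of `C`.
  set h := r / (2 * L) with hh
  have hhpos : 0 < h := by positivity
  have hhρ : h < ρ := by rw [hh, div_lt_iff₀ (by positivity)]; linarith
  have hrh : r = L * (2 * h) := by rw [hh]; field_simp
  have hfc : ContinuousOn f C := hf.lipschitzOnWith.continuousOn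
  set T := C ∩ f ⁻¹' K with hT
  have hTcl : IsClosed T := hfc.preimage_isClosed_of_isClosed hC.isClosed hK
  have hdisj : (ω : Set (EuclideanSpace ℝ (Fin d))).PairwiseDisjoint
      fun x => Metric.ball (τ x) h := by
    intro x hx y hy hxy
    refine Metric.ball_disjoint_ball ?_
    have h1 := hsep x hx y hy hxy
    have h2 := (hf _ (hτω x hx).1 _ (hτω y hy).1).2
    rw [(hτω x hx).2, (hτω y hy).2] at h2
    have h3 : L * (2 * h) ≤ L * dist (τ x) (τ y) := hrh ▸ h1.trans h2
    have := le_of_mul_le_mul_left h3 hL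
    linarith
  have hsub : T ∪ (⋃ x ∈ ω, Metric.ball (τ x) h) ⊆ Metric.cthickening h C := by
    refine Set.union_subset (Set.inter_subset_left.trans (Metric.self_subset_cthickening C)) ?_
    refine Set.iUnion₂_subset fun x hx => ?_
    intro t ht
    exact Metric.mem_cthickening_of_dist_le t (τ x) h C (hτω x hx).1 (Metric.mem_ball.1 ht).le
  have hdisjT : Disjoint T (⋃ x ∈ ω, Metric.ball (τ x) h) := by
    rw [Set.disjoint_left]
    intro t ht ht'
    simp only [Set.mem_iUnion] at ht'
    obtain ⟨x, hx, htx⟩ := ht'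
    have h1 := hfar x hx (f t) ht.2
    have h2 := (hf _ (hτω x hx).1 _ ht.1).2
    rw [(hτω x hx).2] at h2
    have h3 : L * (2 * h) ≤ L * dist (τ x) t := hrh ▸ h1.trans h2
    have h4 := le_of_mul_le_mul_left h3 hL
    have h5 := Metric.mem_ball'.1 htx
    linarith
  have hmeas : volume T + ω.card * ENNReal.ofReal (2 * h) ≤ volume C + ENNReal.ofReal δ := by
    have h1 : volume (⋃ x ∈ ω, Metric.ball (τ x) h) = ω.card * ENNReal.ofReal (2 * h) := by
      rw [measure_biUnion_finset hdisj fun _ _ => measurableSet_ball]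
      simp [Real.volume_ball]
    rw [← h1, ← measure_union' hdisjT hTcl.measurableSet]
    refine (measure_mono hsub).trans (hρ' ?_).le
    rw [dist_zero_right, Real.norm_of_nonneg hhpos.le]
    exact hhρ
  have hCT : volume C = volume T + volume (C \ T) := by
    rw [← measure_inter_add_sdiff C hTcl.measurableSet,
      Set.inter_eq_right.2 (Set.inter_subset_left : T ⊆ C)]
  have hVT : volume T ≠ ∞ := ne_top_of_le_ne_top hVC (measure_mono Set.inter_subset_left)
  rw [hCT, add_assoc] at hmeas
  have hmeas' := ENNReal.le_of_add_le_add_left hVT hmeas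
  have himg : f '' (C \ T) ⊆ f '' C \ K := by
    rintro _ ⟨t, ht, rfl⟩
    exact ⟨⟨t, ht.1, rfl⟩, fun hK => ht.2 ⟨ht.1, hK⟩⟩
  have hdiff : volume (C \ T) ≤ ENNReal.ofReal L * μH[1] (f '' C \ K) :=
    (hf.mono Set.sdiff_subset).volume_le.trans (by gcongr)
  have hfinH : μH[1] (f '' C \ K) ≠ ∞ :=
    ne_top_of_le_ne_top (ENNReal.mul_ne_top ENNReal.ofReal_ne_top hVC)
      ((measure_mono Set.sdiff_subset).trans hf.hausdorffMeasure_image_le)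
  have hfinal := ENNReal.toReal_mono (by finiteness)
    (hmeas'.trans (add_le_add_left hdiff _))
  rw [ENNReal.toReal_add (by finiteness) (by finiteness), ENNReal.toReal_mul, ENNReal.toReal_mul,
    ENNReal.toReal_ofReal hL.le, ENNReal.toReal_ofReal hδ.le, ENNReal.toReal_ofReal (by positivity),
    ENNReal.toReal_natCast] at hfinal
  calc (ω.card : ℝ) * r = L * (ω.card * (2 * h)) := by rw [hrh]; ring
    _ ≤ _ := by gcongr

/-! ### Spread-out selections and the energy upper bound -/

/-- The measure function of a compact set of reals attains every value on the set itself. -/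
theorem exists_expanding_selection {T : Set ℝ} (hT : IsCompact T) :
    ∃ p : ℝ → ℝ, ∀ u ∈ Set.Ioc 0 (volume T).toReal, p u ∈ T ∧
      ∀ v ∈ Set.Ioc 0 (volume T).toReal, |u - v| ≤ |p u - p v| := by
  have hVT : volume T ≠ ∞ := hT.measure_lt_top.ne
  have hfin : ∀ t, volume (T ∩ Set.Iic t) ≠ ∞ := fun t =>
    ne_top_of_le_ne_top hVT (measure_mono Set.inter_subset_left)
  set F : ℝ → ℝ := fun t => (volume (T ∩ Set.Iic t)).toReal with hF
  have hFle : ∀ a b, a ≤ b → F a ≤ F b ∧ F b ≤ F a + (b - a) := by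
    intro a b hab
    constructor
    · exact ENNReal.toReal_mono (hfin b)
        (measure_mono (Set.inter_subset_inter_right _ (Set.Iic_subset_Iic.2 hab)))
    · have hsub : T ∩ Set.Iic b ⊆ (T ∩ Set.Iic a) ∪ Set.Ioc a b := by
        rintro t ⟨ht, htb⟩
        rcases le_or_gt t a with h | h
        · exact Or.inl ⟨ht, h⟩
        · exact Or.inr ⟨h, htb⟩
      have h1 := (measure_mono (μ := volume) hsub).trans (measure_union_le _ _)
      rw [Real.volume_Ioc] at h1
      have h2 := ENNReal.toReal_mono (ENNReal.add_ne_top.2 ⟨hfin a, ENNReal.ofReal_ne_top⟩) h1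
      rwa [ENNReal.toReal_add (hfin a) ENNReal.ofReal_ne_top,
        ENNReal.toReal_ofReal (sub_nonneg.2 hab)] at h2
  have hFabs : ∀ a b, |F a - F b| ≤ |a - b| := by
    intro a b
    rcases le_total a b with h | h
    · have := hFle a b h
      rw [abs_sub_comm, abs_sub_comm a, abs_of_nonneg (by linarith), abs_of_nonneg (by linarith)]
      linarith
    · have := hFle b a h
      rw [abs_of_nonneg (by linarith), abs_of_nonneg (by linarith)]
      linarith
  have hFc : Continuous F := (LipschitzWith.of_dist_le_mul (K := 1) fun a b => by
    simpa [Real.dist_eq] using hFabs a b).continuous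
  have hsurj : ∀ u, ∃ t, u ∈ Set.Ioc 0 (volume T).toReal → t ∈ T ∧ F t = u := by
    intro u
    by_cases hu : u ∈ Set.Ioc 0 (volume T).toReal
    swap
    · exact ⟨0, fun h => absurd h hu⟩
    obtain ⟨R, hR⟩ := hT.isBounded.subset_closedBall 0
    have hbd : ∀ t ∈ T, -(|R| + 1) < t ∧ t ≤ |R| + 1 := fun t ht => by
      have := hR ht
      rw [Metric.mem_closedBall, dist_zero_right, Real.norm_eq_abs, abs_le] at this
      have := le_abs_self R
      constructor <;> linarith
    have h0 : F (-(|R| + 1)) = 0 := by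
      have : T ∩ Set.Iic (-(|R| + 1)) = ∅ := by
        ext t
        simp only [Set.mem_inter_iff, Set.mem_Iic, Set.mem_empty_iff_false, iff_false]
        rintro ⟨ht, ht'⟩
        linarith [(hbd t ht).1]
      simp only [hF, this, measure_empty, ENNReal.toReal_zero]
    have h1 : F (|R| + 1) = (volume T).toReal := by
      have : T ∩ Set.Iic (|R| + 1) = T := Set.inter_eq_left.2 fun t ht => (hbd t ht).2
      simp only [hF, this]
    have hab : -(|R| + 1) ≤ |R| + 1 := by linarith [abs_nonneg R]
    obtain ⟨y, -, hy⟩ := intermediate_value_Icc hab hFc.continuousOn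
      (show u ∈ Set.Icc (F (-(|R| + 1))) (F (|R| + 1)) from by
        rw [h0, h1]; exact ⟨hu.1.le, hu.2⟩)
    -- The point `y` given by the intermediate value theorem may lie outside `T`. The largest point
    -- of `T` below it has the same value of `F`; it exists because `u > 0`.
    have hne : (T ∩ Set.Iic y).Nonempty := by
      by_contra hemp
      rw [Set.not_nonempty_iff_eq_empty] at hemp
      have : F y = 0 := by simp [hF, hemp]
      linarith [hu.1]
    obtain ⟨t, ht, htmax⟩ := (hT.inter_right isClosed_Iic).exists_isGreatest hne
    refine ⟨t, fun _ => ⟨ht.1, ?_⟩⟩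
    have : T ∩ Set.Iic t = T ∩ Set.Iic y := by
      ext z
      exact ⟨fun hz => ⟨hz.1, (Set.mem_Iic.1 hz.2).trans ht.2⟩, fun hz => ⟨hz.1, htmax hz⟩⟩
    rw [← hy]
    simp only [hF, this]
  choose p hp using hsurj
  refine ⟨p, fun u hu => ⟨(hp u hu).1, fun v hv => ?_⟩⟩
  have := hFabs (p u) (p v)
  rwa [(hp u hu).2, (hp v hv).2] at this

/-- `S` contains a copy of the interval `(0, m]` in which distances below some `D > 0` have not
decreased. -/
def HasExpandingSelection (S : Set (EuclideanSpace ℝ (Fin d))) (m : ℝ) : Prop :=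
  ∃ D > 0, ∃ p : ℝ → EuclideanSpace ℝ (Fin d), ∀ u ∈ Set.Ioc 0 m, p u ∈ S ∧
    ∀ v ∈ Set.Ioc 0 m, min |u - v| D ≤ dist (p u) (p v)

theorem HasExpandingSelection.mono {S T : Set (EuclideanSpace ℝ (Fin d))} {m m' : ℝ}
    (h : HasExpandingSelection S m) (hST : S ⊆ T) (hm : m' ≤ m) : HasExpandingSelection T m' := by
  obtain ⟨D, hD, p, hp⟩ := h
  have hsub := Set.Ioc_subset_Ioc_right (b := (0 : ℝ)) hm
  exact ⟨D, hD, p, fun u hu => ⟨hST (hp u (hsub hu)).1, fun v hv => (hp u (hsub hu)).2 v (hsub hv)⟩⟩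

/-- The two selections are concatenated. Points of different sets are at least `δ` apart by
compactness, which is why distances are only controlled up to a cap. -/
theorem HasExpandingSelection.union {S S' : Set (EuclideanSpace ℝ (Fin d))} {m m' : ℝ}
    (h : HasExpandingSelection S m) (h' : HasExpandingSelection S' m') (hS : IsCompact S)
    (hS' : IsCompact S') (hd : Disjoint S S') : HasExpandingSelection (S ∪ S') (m + m') := by
  obtain ⟨D, hD, p, hp⟩ := h
  obtain ⟨D', hD', p', hp'⟩ := h'
  obtain ⟨δ, hδ, hthick⟩ := hd.exists_thickenings hS hS'.isClosed
  have hdist : ∀ x ∈ S, ∀ y ∈ S', δ ≤ dist x y := by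
    intro x hx y hy
    by_contra hlt
    push Not at hlt
    exact Set.disjoint_left.1 hthick (Metric.mem_thickening_iff.2 ⟨x, hx, by rwa [dist_comm]⟩)
      (Metric.self_subset_thickening hδ _ hy)
  refine ⟨min δ (min D D'), by positivity, fun u => if u ≤ m then p u else p' (u - m), ?_⟩
  have hmin1 : min δ (min D D') ≤ δ := min_le_left _ _
  have hmin2 : min δ (min D D') ≤ D := (min_le_right _ _).trans (min_le_left _ _)
  have hmin3 : min δ (min D D') ≤ D' := (min_le_right _ _).trans (min_le_right _ _)
  intro u hu
  by_cases hum : u ≤ m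
  · simp only [hum, if_true]
    have hu' : u ∈ Set.Ioc 0 m := ⟨hu.1, hum⟩
    refine ⟨Or.inl (hp u hu').1, fun v hv => ?_⟩
    by_cases hvm : v ≤ m
    · simp only [hvm, if_true]
      exact (min_le_min_left _ hmin2).trans ((hp u hu').2 v ⟨hv.1, hvm⟩)
    · simp only [hvm, if_false]
      push Not at hvm
      exact (min_le_right _ _).trans (hmin1.trans (hdist _ (hp u hu').1 _
        (hp' (v - m) ⟨by linarith, by linarith [hv.2]⟩).1))
  · simp only [hum, if_false]
    push Not at hum
    have hu' : u - m ∈ Set.Ioc 0 m' := ⟨by linarith, by linarith [hu.2]⟩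
    refine ⟨Or.inr (hp' _ hu').1, fun v hv => ?_⟩
    by_cases hvm : v ≤ m
    · simp only [hvm, if_true]
      rw [dist_comm]
      exact (min_le_right _ _).trans (hmin1.trans (hdist _ (hp v ⟨hv.1, hvm⟩).1 _
        (hp' _ hu').1))
    · simp only [hvm, if_false]
      push Not at hvm
      have := (hp' _ hu').2 (v - m) ⟨by linarith, by linarith [hv.2]⟩
      rw [sub_sub_sub_cancel_right] at this
      exact (min_le_min_left _ hmin3).trans this

theorem HasExpandingSelection.biUnion {Q : ℕ → Set (EuclideanSpace ℝ (Fin d))} {m : ℕ → ℝ}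
    (h : ∀ j, HasExpandingSelection (Q j) (m j)) (hQ : ∀ j, IsCompact (Q j))
    (hd : Pairwise (Function.onFun Disjoint Q)) (N : ℕ) :
    HasExpandingSelection (⋃ j ∈ Finset.range N, Q j) (∑ j ∈ Finset.range N, m j) := by
  induction N with
  | zero => exact ⟨1, one_pos, fun _ => 0, fun u hu => by simp at hu⟩
  | succ N ih =>
    rw [Finset.sum_range_succ, Finset.range_add_one, Finset.set_biUnion_insert, Set.union_comm]
    refine ih.union (h N) ((Finset.range N).isCompact_biUnion fun j _ => hQ j) (hQ N) ?_
    simp only [Set.disjoint_iUnion_left]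
    intro j hj
    exact hd (Finset.mem_range.1 hj).ne

/-- The selection in the coordinate image is lifted to `Q`: the coordinate is `1`-Lipschitz, so
lifting does not shrink distances, and its inverse is `(1 + ε)`-Lipschitz, so the image is long
enough. The cap `1` is arbitrary here. -/
theorem hasExpandingSelection_of_isNearlyLinear {ε : ℝ} (hε : 0 < ε)
    {Q : Set (EuclideanSpace ℝ (Fin d))} (hQ : IsCompact Q) (hlin : IsNearlyLinear ε Q) :
    HasExpandingSelection Q ((μH[1] Q).toReal / (1 + ε)) := by
  obtain ⟨g, hg, hg'⟩ := hlin
  have hT := hQ.image hg.continuous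
  obtain ⟨p, hp⟩ := exists_expanding_selection hT
  have hinj : Set.InjOn g Q := fun x hx y hy hxy => by
    have := hg' x hx y hy
    rw [hxy, sub_self, abs_zero, mul_zero] at this
    exact dist_le_zero.1 this
  have hlip : LipschitzOnWith (1 + ε).toNNReal (Function.invFunOn g Q) (g '' Q) := by
    refine LipschitzOnWith.of_dist_le_mul ?_
    rintro _ ⟨x, hx, rfl⟩ _ ⟨y, hy, rfl⟩
    rw [hinj.leftInvOn_invFunOn hx, hinj.leftInvOn_invFunOn hy,
      Real.coe_toNNReal _ (by linarith)]
    exact hg' x hx y hy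
  have hvol : (μH[1] Q).toReal / (1 + ε) ≤ (volume (g '' Q)).toReal := by
    have h1 := hlip.hausdorffMeasure_image_le zero_le_one
    rw [ENNReal.rpow_one, hausdorffMeasure_real, hinj.invFunOn_image subset_rfl] at h1
    have h2 := ENNReal.toReal_mono (ENNReal.mul_ne_top ENNReal.coe_ne_top hT.measure_lt_top.ne) h1
    rw [ENNReal.toReal_mul, ENNReal.coe_toReal, Real.coe_toNNReal _ (by linarith)] at h2
    rw [div_le_iff₀ (by linarith)]
    linarith
  refine HasExpandingSelection.mono (S := Q) ⟨1, one_pos, fun u => Function.invFunOn g Q (p u), ?_⟩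
    subset_rfl hvol
  intro u hu
  have hinv : ∀ u ∈ Set.Ioc 0 (volume (g '' Q)).toReal, Function.invFunOn g Q (p u) ∈ Q ∧
      g (Function.invFunOn g Q (p u)) = p u := fun u hu =>
    ⟨Function.invFunOn_mem (hp u hu).1, Function.invFunOn_eq (hp u hu).1⟩
  refine ⟨(hinv u hu).1, fun v hv => (min_le_left _ _).trans (((hp u hu).2 v hv).trans ?_)⟩
  have := hg.dist_le_mul (Function.invFunOn g Q (p u)) (Function.invFunOn g Q (p v))
  rw [(hinv u hu).2, (hinv v hv).2] at this
  simpa [Real.dist_eq] using this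

/-- Equally spaced parameters are used. A pair is either at least as far apart as its parameters,
which gives the zeta term, or at least `D` apart, which gives the quadratic term. -/
theorem HasExpandingSelection.exists_energy_le (hs : 1 < s)
    {S : Set (EuclideanSpace ℝ (Fin d))} {m : ℝ} (hm : 0 < m) (h : HasExpandingSelection S m) :
    ∃ D > 0, ∀ N : ℕ, ∃ ω : Finset (EuclideanSpace ℝ (Fin d)),
      ω.card = N ∧ (ω : Set _) ⊆ S ∧
      energy s ω ≤ 2 * (riemannZeta (s : ℂ)).re / m ^ s * (N : ℝ) ^ (1 + s)
        + 2 / D ^ s * (N : ℝ) ^ (2 : ℝ) := by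
  classical
  obtain ⟨D, hD, p, hp⟩ := h
  refine ⟨D, hD, fun N => ?_⟩
  -- The shift by `1` avoids the parameter `0`, which is excluded from the interval.
  set x : ℕ → EuclideanSpace ℝ (Fin d) := fun i => p (((i : ℝ) + 1) * (m / N)) with hx
  have hmem : ∀ i < N, ((i : ℝ) + 1) * (m / N) ∈ Set.Ioc 0 m := by
    intro i hi
    have hN : (0 : ℝ) < N := by exact_mod_cast (Nat.zero_le i).trans_lt hi
    have hi' : (i : ℝ) + 1 ≤ N := by exact_mod_cast hi
    refine ⟨by positivity, ?_⟩
    calc ((i : ℝ) + 1) * (m / N) ≤ N * (m / N) := by gcongr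
      _ = m := by field_simp
  have hdist : ∀ i < N, ∀ j < N, min (|(i : ℝ) - j| * (m / N)) D ≤ dist (x i) (x j) := by
    intro i hi j hj
    have := (hp _ (hmem i hi)).2 _ (hmem j hj)
    rwa [← sub_mul, abs_mul, add_sub_add_right_eq_sub, abs_of_nonneg (a := m / N) (by positivity)]
      at this
  have hinj : Set.InjOn x (Finset.range N) := by
    intro i hi j hj hij
    simp only [Finset.coe_range, Set.mem_Iio] at hi hj
    by_contra hne
    have h1 := hdist i hi j hj
    rw [hij, dist_self] at h1
    have hN : (0 : ℝ) < N := by exact_mod_cast (Nat.zero_le i).trans_lt hi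
    have h2 : 0 < |(i : ℝ) - j| := abs_pos.2 (sub_ne_zero.2 (by exact_mod_cast hne))
    have : 0 < min (|(i : ℝ) - j| * (m / N)) D := by positivity
    linarith
  refine ⟨(Finset.range N).image x, by rw [Finset.card_image_of_injOn hinj, Finset.card_range],
    ?_, ?_⟩
  · intro y hy
    obtain ⟨i, hi, rfl⟩ := Finset.mem_image.1 hy
    exact (hp _ (hmem i (Finset.mem_range.1 hi))).1
  rw [energy_image_range hinj]
  have hterm : ∀ i ∈ Finset.range N, ∀ k ∈ Finset.range i,
      1 / dist (x i) (x (i - 1 - k)) ^ s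
        ≤ ((N : ℝ) / m) ^ s * (1 / ((k : ℝ) + 1) ^ s) + 1 / D ^ s := by
    intro i hi k hk
    have hi := Finset.mem_range.1 hi
    have hk := Finset.mem_range.1 hk
    have hN : (0 : ℝ) < N := by exact_mod_cast (Nat.zero_le i).trans_lt hi
    have h1 := hdist i hi (i - 1 - k) (by omega)
    have h2 : |(i : ℝ) - ((i - 1 - k : ℕ) : ℝ)| = (k : ℝ) + 1 := by
      rw [Nat.sub_sub, Nat.cast_sub (by omega)]
      push_cast
      rw [abs_of_nonneg] <;> linarith [(Nat.cast_nonneg k : (0 : ℝ) ≤ k)]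
    rw [h2] at h1
    have h3 : ((N : ℝ) / m) ^ s * (1 / ((k : ℝ) + 1) ^ s)
        = 1 / (((k : ℝ) + 1) * (m / N)) ^ s := by
      rw [Real.mul_rpow (by positivity) (by positivity), Real.div_rpow hN.le hm.le,
        Real.div_rpow hm.le hN.le]
      field_simp
    rw [h3]
    rcases min_le_iff.1 h1 with h | h
    · have : 1 / dist (x i) (x (i - 1 - k)) ^ s ≤ 1 / (((k : ℝ) + 1) * (m / N)) ^ s := by
        gcongr
      have : 0 ≤ 1 / D ^ s := by positivity
      linarith
    · have : 1 / dist (x i) (x (i - 1 - k)) ^ s ≤ 1 / D ^ s := by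
        gcongr
      have : 0 ≤ 1 / (((k : ℝ) + 1) * (m / N)) ^ s := by positivity
      linarith
  have hrow : ∀ i ∈ Finset.range N, ∑ k ∈ Finset.range i, 1 / dist (x i) (x (i - 1 - k)) ^ s
      ≤ ((N : ℝ) / m) ^ s * (riemannZeta (s : ℂ)).re + N * (1 / D ^ s) := by
    intro i hi
    refine (Finset.sum_le_sum (hterm i hi)).trans ?_
    rw [Finset.sum_add_distrib, ← Finset.mul_sum, Finset.sum_const, Finset.card_range,
      nsmul_eq_mul]
    have h1 := (zeta_facts hs).1 i
    rw [partialZeta] at h1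
    have h2 : (i : ℝ) ≤ N := by exact_mod_cast (Finset.mem_range.1 hi).le
    gcongr
    linarith
  calc 2 * ∑ i ∈ Finset.range N, ∑ k ∈ Finset.range i, 1 / dist (x i) (x (i - 1 - k)) ^ s
      ≤ 2 * (N * (((N : ℝ) / m) ^ s * (riemannZeta (s : ℂ)).re + N * (1 / D ^ s))) := by
        gcongr
        refine (Finset.sum_le_sum hrow).trans ?_
        rw [Finset.sum_const, Finset.card_range, nsmul_eq_mul]
    _ = _ := by
        rcases Nat.eq_zero_or_pos N with rfl | hN
        · have : 1 + s ≠ 0 := by linarith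
          simp [Real.zero_rpow this]
        have hN' : (0 : ℝ) < N := by exact_mod_cast hN
        rw [Real.rpow_add hN', Real.rpow_one, Real.div_rpow hN'.le hm.le, Real.rpow_two]
        ring

/-! ### Moving points and counting close neighbours -/

theorem energy_image_le (hs : 0 < s) [DecidableEq (EuclideanSpace ℝ (Fin d))]
    {ω : Finset (EuclideanSpace ℝ (Fin d))}
    {π : EuclideanSpace ℝ (Fin d) → EuclideanSpace ℝ (Fin d)} {a : ℝ} (ha : 0 < a)
    (hπ : ∀ x ∈ ω, ∀ y ∈ ω, a * dist x y ≤ dist (π x) (π y)) :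
    (ω.image π).card = ω.card ∧ a ^ s * energy s (ω.image π) ≤ energy s ω := by
  classical
  have hinj : Set.InjOn π ω := fun x hx y hy hxy => by
    have := hπ x hx y hy
    rw [hxy, dist_self] at this
    exact dist_le_zero.1 (nonpos_of_mul_nonpos_right this ha)
  refine ⟨Finset.card_image_of_injOn hinj, ?_⟩
  have heq : energy s (ω.image π) = ∑ y ∈ ω, ∑ x ∈ ω.erase y, 1 / dist (π x) (π y) ^ s := by
    rw [← energy_image (s := s) hinj]
    congr
    exact Subsingleton.elim _ _
  rw [heq, Finset.mul_sum]
  unfold energy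
  refine Finset.sum_le_sum fun y hy => ?_
  rw [Finset.mul_sum]
  refine Finset.sum_le_sum_of_subset_of_nonneg (by intro x; simp) (fun _ _ _ => by positivity)
    |>.trans' (Finset.sum_le_sum fun x hx => ?_)
  obtain ⟨hxy, hx⟩ := Finset.mem_erase.1 hx
  have h0 : 0 < dist x y := dist_pos.2 hxy
  have h1 := hπ x hx y hy
  have h2 : 0 < dist (π x) (π y) := (by positivity : 0 < a * dist x y).trans_le h1
  have h3 : (a * dist x y) ^ s ≤ dist (π x) (π y) ^ s := by gcongr
  rw [Real.mul_rpow ha.le h0.le] at h3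
  have h4 := Real.rpow_pos_of_pos h0 s
  rw [mul_one_div, div_le_div_iff₀ (by positivity) h4]
  linarith

/-- Only few points of a configuration can have a close neighbour. -/
theorem card_close_mul_le_energy (hs : 0 < s) (ω : Finset (EuclideanSpace ℝ (Fin d))) {r : ℝ}
    {B : Finset (EuclideanSpace ℝ (Fin d))} (hBω : B ⊆ ω)
    (hB : ∀ y ∈ B, ∃ x ∈ ω, x ≠ y ∧ dist x y < r) :
    (B.card : ℝ) * (1 / r ^ s) ≤ energy s ω := by
  classical
  unfold energy
  refine (Finset.sum_le_sum_of_subset_of_nonneg hBω fun _ _ _ =>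
    Finset.sum_nonneg fun _ _ => by positivity).trans' ?_
  rw [← nsmul_eq_mul, ← Finset.sum_const]
  refine Finset.sum_le_sum fun y hy => ?_
  obtain ⟨x, hx, hxy, hlt⟩ := hB y hy
  have h0 : 0 < dist x y := dist_pos.2 hxy
  have hle : 1 / r ^ s ≤ 1 / dist x y ^ s := by gcongr
  refine hle.trans ?_
  exact Finset.single_le_sum (f := fun x => 1 / dist x y ^ s) (fun _ _ => by positivity)
    (by simp [hxy, hx])

/-! ### Finite measure, decomposition and packing for the whole set -/

theorem hausdorffMeasure_ne_top_of_rectifiable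
    {M A : Set (EuclideanSpace ℝ (Fin d))} (hM : IsRectifiableManifold 1 M) (hAM : A ⊆ M)
    (hA : IsCompact A) : μH[1] A ≠ ∞ := by
  obtain ⟨n, L, C, f, hL, hCf, hAC⟩ := hM.exists_biLipschitzBound hAM hA
  rw [hAC]
  refine ne_top_of_le_ne_top ?_ (measure_iUnion_le _)
  rw [tsum_fintype]
  refine ENNReal.sum_ne_top.2 fun k _ => ne_top_of_le_ne_top ?_ (hCf k).2.hausdorffMeasure_image_le
  exact ENNReal.mul_ne_top ENNReal.ofReal_ne_top (hCf k).1.measure_lt_top.ne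

theorem exists_disjoint_isNearlyLinear_of_rectifiable
    {M A : Set (EuclideanSpace ℝ (Fin d))} (hM : IsRectifiableManifold 1 M) (hAM : A ⊆ M)
    (hA : IsCompact A)
    {ε : ℝ} (hε : 0 < ε) {η : ℝ} (hη : 0 < η) :
    ∃ (N : ℕ) (Q : ℕ → Set (EuclideanSpace ℝ (Fin d))),
      (∀ j, IsCompact (Q j) ∧ IsNearlyLinear ε (Q j) ∧ Q j ⊆ A) ∧
      Pairwise (Function.onFun Disjoint Q) ∧
      (μH[1] (A \ ⋃ j ∈ Finset.range N, Q j)).toReal ≤ η ∧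
      (μH[1] A).toReal ≤ ∑ j ∈ Finset.range N, (μH[1] (Q j)).toReal + η ∧
      ∑ j ∈ Finset.range N, (μH[1] (Q j)).toReal ≤ (μH[1] A).toReal := by
  have hfin := hausdorffMeasure_ne_top_of_rectifiable hM hAM hA
  obtain ⟨n, L, C, f, hL, hCf, hAC⟩ := hM.exists_biLipschitzBound hAM hA
  obtain ⟨N, Q, hQ, hdisj, hμ⟩ := exists_disjoint_isNearlyLinear hA hfin hL (fun k => (hCf k).2)
    hAC hε (η := ENNReal.ofReal η) (by simpa using hη)
  have hsub : (⋃ j ∈ Finset.range N, Q j) ⊆ A := Set.iUnion₂_subset fun j _ => (hQ j).2.2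
  have hsum : (μH[1] (⋃ j ∈ Finset.range N, Q j)).toReal
      = ∑ j ∈ Finset.range N, (μH[1] (Q j)).toReal := by
    rw [measure_biUnion_finset (fun i _ j _ hij => hdisj hij)
      (fun j _ => (hQ j).1.measurableSet), ENNReal.toReal_sum]
    exact fun j _ => ne_top_of_le_ne_top hfin (measure_mono (hQ j).2.2)
  have hμ' := ENNReal.toReal_mono ENNReal.ofReal_ne_top hμ
  rw [ENNReal.toReal_ofReal hη.le] at hμ'
  refine ⟨N, Q, hQ, hdisj, hμ', ?_, ?_⟩
  · have h1 : μH[1] A ≤ μH[1] (⋃ j ∈ Finset.range N, Q j)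
        + μH[1] (A \ ⋃ j ∈ Finset.range N, Q j) :=
      (measure_mono fun x hx => (em _).imp id fun h => ⟨hx, h⟩).trans (measure_union_le _ _)
    have hf1 : μH[1] (⋃ j ∈ Finset.range N, Q j) ≠ ∞ :=
      ne_top_of_le_ne_top hfin (measure_mono hsub)
    have hf2 : μH[1] (A \ ⋃ j ∈ Finset.range N, Q j) ≠ ∞ :=
      ne_top_of_le_ne_top hfin (measure_mono Set.sdiff_subset)
    have h2 := ENNReal.toReal_mono (ENNReal.add_ne_top.2 ⟨hf1, hf2⟩) h1
    rw [ENNReal.toReal_add hf1 hf2, hsum] at h2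
    linarith
  · rw [← hsum]
    exact ENNReal.toReal_mono hfin (measure_mono hsub)

theorem exists_card_mul_le_of_separated
    {M A : Set (EuclideanSpace ℝ (Fin d))} (hM : IsRectifiableManifold 1 M) (hAM : A ⊆ M)
    (hA : IsCompact A) :
    ∃ c : ℝ, 0 < c ∧ ∀ δ > 0, ∃ r₀ > 0, ∀ K : Set (EuclideanSpace ℝ (Fin d)), IsClosed K →
      ∀ r, 0 < r → r < r₀ → ∀ ω : Finset (EuclideanSpace ℝ (Fin d)), (ω : Set _) ⊆ A →
      (∀ x ∈ ω, ∀ y ∈ ω, x ≠ y → r ≤ dist x y) → (∀ x ∈ ω, ∀ y ∈ K, r ≤ dist x y) →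
      (ω.card : ℝ) * r ≤ c * ((μH[1] (A \ K)).toReal + δ) := by
  classical
  have hfin := hausdorffMeasure_ne_top_of_rectifiable hM hAM hA
  obtain ⟨n, L, C, f, hL, hCf, hAC⟩ := hM.exists_biLipschitzBound hAM hA
  refine ⟨(n + 1) * (L * (L + 1)), by positivity, fun δ hδ => ?_⟩
  choose ρ hρ hcard using fun k => card_mul_le_of_separated hL (hCf k).1 (hCf k).2 hδ
  obtain ⟨r₀, hr₀, hr₀ρ⟩ : ∃ r₀ > 0, ∀ k, r₀ ≤ ρ k := by
    have h1 : ∀ᶠ r in 𝓝[>] (0 : ℝ), ∀ k, r ≤ ρ k :=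
      eventually_all.2 fun k => mem_of_superset (Ioo_mem_nhdsGT (hρ k)) fun r hr => hr.2.le
    obtain ⟨r, hr, hr'⟩ := (h1.and self_mem_nhdsWithin).exists
    exact ⟨r, hr', hr⟩
  refine ⟨r₀, hr₀, fun K hK r hr hrr₀ ω hω hsep hfar => ?_⟩
  have hsubA : ∀ k, f k '' C k ⊆ A := fun k => hAC ▸ Set.subset_iUnion (fun k => f k '' C k) k
  set x := (μH[1] (A \ K)).toReal with hx
  have hx0 : 0 ≤ x := ENNReal.toReal_nonneg
  have hk : ∀ k, ((ω.filter (· ∈ f k '' C k)).card : ℝ) * r ≤ L * (L + 1) * (x + δ) := by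
    intro k
    have h1 := hcard k K hK r hr (hrr₀.trans_le (hr₀ρ k)) (ω.filter (· ∈ f k '' C k))
      (fun y hy => (Finset.mem_filter.1 hy).2)
      (fun y hy z hz => hsep y (Finset.mem_filter.1 hy).1 z (Finset.mem_filter.1 hz).1)
      (fun y hy => hfar y (Finset.mem_filter.1 hy).1)
    have h2 : (μH[1] (f k '' C k \ K)).toReal ≤ x :=
      ENNReal.toReal_mono (ne_top_of_le_ne_top hfin (measure_mono Set.sdiff_subset))
        (measure_mono (Set.sdiff_subset_sdiff_left (hsubA k)))
    refine h1.trans ?_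
    rw [mul_assoc]
    refine mul_le_mul_of_nonneg_left ?_ hL.le
    nlinarith
  have hcov : ω ⊆ Finset.univ.biUnion fun k => ω.filter (· ∈ f k '' C k) := by
    intro y hy
    have := hω hy
    rw [hAC] at this
    obtain ⟨k, hk⟩ := Set.mem_iUnion.1 this
    exact Finset.mem_biUnion.2 ⟨k, Finset.mem_univ k, Finset.mem_filter.2 ⟨hy, hk⟩⟩
  have hcardle : (ω.card : ℝ) ≤ ∑ k, ((ω.filter (· ∈ f k '' C k)).card : ℝ) := by
    exact_mod_cast (Finset.card_le_card hcov).trans Finset.card_biUnion_le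
  calc (ω.card : ℝ) * r ≤ ∑ k, ((ω.filter (· ∈ f k '' C k)).card : ℝ) * r := by
        rw [← Finset.sum_mul]; gcongr
    _ ≤ ∑ k : Fin n, L * (L + 1) * (x + δ) := Finset.sum_le_sum fun k _ => hk k
    _ = n * (L * (L + 1)) * (x + δ) := by
        rw [Finset.sum_const, Finset.card_univ, Fintype.card_fin, nsmul_eq_mul]; ring
    _ ≤ (n + 1) * (L * (L + 1)) * (x + δ) := by gcongr; linarith

/-! ### The two asymptotic bounds -/

theorem eventually_exists_energy_le
    {M A : Set (EuclideanSpace ℝ (Fin d))} (hM : IsRectifiableManifold 1 M) (hAM : A ⊆ M)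
    (hA : IsCompact A)
    (hs : 1 < s) (hpos : 0 < (μH[1] A).toReal) {t : ℝ}
    (ht : 2 * (riemannZeta (s : ℂ)).re < t * (μH[1] A).toReal ^ s) :
    ∀ᶠ N : ℕ in atTop, ∃ ω : Finset (EuclideanSpace ℝ (Fin d)), ω.card = N ∧ (ω : Set _) ⊆ A ∧
      energy s ω ≤ t * (N : ℝ) ^ (1 + s) := by
  set h := (μH[1] A).toReal with hh
  set Z := 2 * (riemannZeta (s : ℂ)).re with hZ
  have hcont : Tendsto (fun ε : ℝ => t * ((h - ε) / (1 + ε)) ^ s) (𝓝[>] 0)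
      (𝓝 (t * h ^ s)) := by
    have : ContinuousAt (fun ε : ℝ => t * ((h - ε) / (1 + ε)) ^ s) 0 := by
      refine continuousAt_const.mul (ContinuousAt.rpow_const ?_ (Or.inr (by linarith)))
      exact ContinuousAt.div (by fun_prop) (by fun_prop) (by norm_num)
    have := this.tendsto
    simp only [sub_zero, add_zero, div_one] at this
    exact this.mono_left nhdsWithin_le_nhds
  obtain ⟨ε, ⟨hεt, hεh⟩, hε⟩ := (((tendsto_order.1 hcont).1 _ ht).and
    (Ioo_mem_nhdsGT hpos)).and self_mem_nhdsWithin |>.exists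
  have hε : 0 < ε := hε
  obtain ⟨N, Q, hQ, hdisj, -, hsum, -⟩ :=
    exists_disjoint_isNearlyLinear_of_rectifiable hM hAM hA hε hε
  set m := (h - ε) / (1 + ε) with hm
  have hmpos : 0 < m := div_pos (sub_pos.2 hεh.2) (by linarith)
  have hsel : HasExpandingSelection A m := by
    refine (HasExpandingSelection.biUnion (fun j => hasExpandingSelection_of_isNearlyLinear hε
      (hQ j).1 (hQ j).2.1) (fun j => (hQ j).1) hdisj N).mono
      (Set.iUnion₂_subset fun j _ => (hQ j).2.2) ?_
    rw [← Finset.sum_div, hm]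
    gcongr
    linarith
  obtain ⟨D, hD, hω⟩ := hsel.exists_energy_le hs hmpos
  have hms := Real.rpow_pos_of_pos hmpos s
  have hgap : 0 < t - Z / m ^ s := by
    rw [sub_pos, div_lt_iff₀ hms]; exact hεt
  -- The quadratic term divided by `N^(1+s)` is a multiple of `N^(1-s)`; here `s > 1` is essential.
  have hlim : Tendsto (fun N : ℕ => 2 / D ^ s * (N : ℝ) ^ (-(s - 1))) atTop (𝓝 0) := by
    have := ((tendsto_rpow_neg_atTop (sub_pos.2 hs)).comp tendsto_natCast_atTop_atTop).const_mul
      (2 / D ^ s)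
    simpa using this
  filter_upwards [(tendsto_order.1 hlim).2 _ hgap, eventually_gt_atTop 0] with n hn hn0
  obtain ⟨ω, hcard, hωA, hE⟩ := hω n
  refine ⟨ω, hcard, hωA, hE.trans ?_⟩
  have hn' : (0 : ℝ) < n := by exact_mod_cast hn0
  have h1 : (n : ℝ) ^ (2 : ℝ) = (n : ℝ) ^ (-(s - 1)) * (n : ℝ) ^ (1 + s) := by
    rw [← Real.rpow_add hn']; ring_nf
  have h2 := Real.rpow_pos_of_pos hn' (1 + s)
  rw [h1, ← mul_assoc, ← add_mul]
  gcongr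
  linarith

/-- A configuration of too small energy would, after discarding about `2θN` points and moving the
others into the union `K` of finitely many nearly linear pieces, violate the lower bound on `K`. -/
theorem eventually_le_energy
    {M A : Set (EuclideanSpace ℝ (Fin d))} (hM : IsRectifiableManifold 1 M) (hAM : A ⊆ M)
    (hA : IsCompact A)
    (hs : 1 < s) {t : ℝ} (ht0 : 0 < t)
    (ht : t * (μH[1] A).toReal ^ s < 2 * (riemannZeta (s : ℂ)).re) :
    ∀ᶠ N : ℕ in atTop, ∀ ω : Finset (EuclideanSpace ℝ (Fin d)), ω.card = N → (ω : Set _) ⊆ A →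
      t * (N : ℝ) ^ (1 + s) ≤ energy s ω := by
  classical
  have hs0 : 0 < s := by linarith
  have hfin := hausdorffMeasure_ne_top_of_rectifiable hM hAM hA
  set h := (μH[1] A).toReal with hh
  have hh0 : 0 ≤ h := ENNReal.toReal_nonneg
  set Z := 2 * (riemannZeta (s : ℂ)).re with hZ
  -- At `θ = 0` the inequality is the hypothesis `ht`. The factor `1 - 2 * θ` pays for moving
  -- points, `1 - 3 * θ` for lost points, and the enlarged length for the pieces.
  obtain ⟨θ, hθ0, hθ1, hθ⟩ : ∃ θ : ℝ, 0 < θ ∧ θ < 1 / 4 ∧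
      t * ((1 + θ) * (h + θ) + θ) ^ s < (1 - 2 * θ) ^ s * (1 - 3 * θ) ^ (1 + s) * Z := by
    have hc : ContinuousAt (fun θ : ℝ => (1 - 2 * θ) ^ s * (1 - 3 * θ) ^ (1 + s) * Z
        - t * ((1 + θ) * (h + θ) + θ) ^ s) 0 := by
      refine ((ContinuousAt.rpow_const (by fun_prop) (Or.inr hs0.le)).mul
        (ContinuousAt.rpow_const (by fun_prop) (Or.inr (by linarith)))).mul continuousAt_const |>.sub
        (continuousAt_const.mul (ContinuousAt.rpow_const (by fun_prop) (Or.inr hs0.le)))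
    have hc' := hc.tendsto
    simp only [mul_zero, sub_zero, add_zero, Real.one_rpow, one_mul] at hc'
    obtain ⟨θ, ⟨h1, h2⟩, h3⟩ := ((((tendsto_order.1 hc').1 0 (by linarith)).filter_mono
      nhdsWithin_le_nhds).and (Ioo_mem_nhdsGT (by norm_num : (0 : ℝ) < 1 / 4))).and
      (self_mem_nhdsWithin (s := Set.Ioi (0 : ℝ))) |>.exists
    exact ⟨θ, h3, h2.2, by linarith⟩
  set ℓ := (1 + θ) * (h + θ) + θ with hℓ
  have hℓ0 : 0 < ℓ := by positivity
  have h2θ : 0 < 1 - 2 * θ := by linarith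
  have h3θ : 0 < 1 - 3 * θ := by linarith
  obtain ⟨κ, hκ⟩ : ∃ κ, t * ℓ ^ s
      < (1 - 2 * θ) ^ s * (1 - 3 * θ) ^ (1 + s) * partialZeta s κ :=
    ((tendsto_order.1 ((zeta_facts hs).2.const_mul
      ((1 - 2 * θ) ^ s * (1 - 3 * θ) ^ (1 + s)))).1 _ hθ).exists
  -- If the energy is below `t N^(1+s)`, at most `t c^s N = θN` points can have a neighbour within
  -- `c / N`.
  obtain ⟨c, hc0, hc⟩ : ∃ c : ℝ, 0 < c ∧ t * c ^ s = θ := by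
    refine ⟨(θ / t) ^ s⁻¹, by positivity, ?_⟩
    rw [Real.rpow_inv_rpow (by positivity) hs0.ne']
    field_simp
  obtain ⟨P, hP0, hP⟩ := exists_card_mul_le_of_separated hM hAM hA
  -- Chosen so that `P * (e + e) = θ * (θ * c)`: at most `θN` points that are `θc/N`-separated can
  -- stay `θc/N` away from `K`.
  set e := θ * (θ * c) / (2 * P) with he
  have he0 : 0 < e := by positivity
  obtain ⟨r₀, hr₀, hpack⟩ := hP e he0
  obtain ⟨J, Q, hQ, hdisj, hμ, -, hsum⟩ :=
    exists_disjoint_isNearlyLinear_of_rectifiable hM hAM hA hθ0 he0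
  set K := ⋃ j ∈ Finset.range J, Q j with hK
  have hKcl : IsClosed K := ((Finset.range J).isCompact_biUnion fun j _ => (hQ j).1).isClosed
  obtain ⟨C, hC⟩ : HasEnergyLowerBound s κ K ℓ := by
    have hδ : 0 < θ / (J + 1) := by positivity
    have hpos : ∀ j ∈ Finset.range J, 0 < (1 + θ) * ((μH[1] (Q j)).toReal + θ / (J + 1)) :=
      fun j _ => mul_pos (by linarith) (add_pos_of_nonneg_of_pos ENNReal.toReal_nonneg hδ)
    refine (HasEnergyLowerBound.biUnion hs0 (Finset.range J) hpos hθ0 fun j _ =>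
      hasEnergyLowerBound_of_isNearlyLinear hs0 κ hθ0 hδ (hQ j).1 (hQ j).2.1
        (ne_top_of_le_ne_top hfin (measure_mono (hQ j).2.2))).mono hs0 subset_rfl
        (add_pos_of_nonneg_of_pos (Finset.sum_nonneg fun j hj => (hpos j hj).le) hθ0) ?_
    rw [← Finset.mul_sum, Finset.sum_add_distrib, Finset.sum_const, Finset.card_range,
      nsmul_eq_mul, hℓ]
    have : (J : ℝ) * (θ / (J + 1)) ≤ θ := by
      rw [mul_div_assoc', div_le_iff₀ (by positivity)]
      nlinarith
    gcongr
  have hlarge : ∀ᶠ N : ℕ in atTop, max (C / θ) (θ * c / r₀) < (N : ℝ) :=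
    tendsto_natCast_atTop_atTop.eventually_gt_atTop _
  filter_upwards [hlarge, eventually_gt_atTop 0] with N hN hN0 ω hcard hωA
  have hN' : (0 : ℝ) < N := by exact_mod_cast hN0
  have hNs := Real.rpow_pos_of_pos hN' (1 + s)
  have hNC : C < θ * N := by
    have := (le_max_left _ _).trans_lt hN
    rwa [div_lt_iff₀ hθ0, mul_comm] at this
  have hNr : θ * c / N < r₀ := by
    have := (le_max_right _ _).trans_lt hN
    rw [div_lt_iff₀ hr₀] at this
    rw [div_lt_iff₀ hN']
    linarith
  by_contra! hlt
  set B := ω.filter fun y => ∃ x ∈ ω, x ≠ y ∧ dist x y < c / N with hB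
  set G := ω.filter fun y => ¬ ∃ x ∈ ω, x ≠ y ∧ dist x y < c / N with hG
  have hBG : (B.card : ℝ) + G.card = N := by
    rw [← hcard]
    exact_mod_cast Finset.card_filter_add_card_filter_not (s := ω) _
  have hBcard : (B.card : ℝ) ≤ θ * N := by
    have h1 := (card_close_mul_le_energy hs0 ω (r := c / N) (Finset.filter_subset _ ω)
      fun y hy => (Finset.mem_filter.1 hy).2).trans hlt.le
    rw [Real.div_rpow hc0.le hN'.le, one_div_div, ← hB, Real.rpow_add hN', Real.rpow_one] at h1
    have h2 := Real.rpow_pos_of_pos hN' s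
    have h3 := Real.rpow_pos_of_pos hc0 s
    rw [mul_div_assoc', div_le_iff₀ h3] at h1
    have h4 : (B.card : ℝ) * (N : ℝ) ^ s ≤ θ * N * (N : ℝ) ^ s := by
      rw [← hc]; linarith
    exact le_of_mul_le_mul_right h4 h2
  have hGsep : ∀ x ∈ G, ∀ y ∈ G, x ≠ y → c / N ≤ dist x y := by
    intro x hx y hy hxy
    by_contra hlt
    push Not at hlt
    exact (Finset.mem_filter.1 hy).2 ⟨x, (Finset.mem_filter.1 hx).1, hxy, hlt⟩
  set F := G.filter fun x => ∀ y ∈ K, θ * c / N ≤ dist x y with hF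
  set H := G.filter fun x => ¬ ∀ y ∈ K, θ * c / N ≤ dist x y with hH
  have hFH : (F.card : ℝ) + H.card = G.card := by
    exact_mod_cast Finset.card_filter_add_card_filter_not (s := G) _
  have hFcard : (F.card : ℝ) ≤ θ * N := by
    have h1 := hpack K hKcl (θ * c / N) (by positivity) hNr F
      (fun x hx => hωA (Finset.mem_filter.1 (Finset.mem_filter.1 hx).1).1)
      (fun x hx y hy hxy => le_trans (by gcongr; nlinarith)
        (hGsep x (Finset.mem_filter.1 hx).1 y (Finset.mem_filter.1 hy).1 hxy))
      (fun x hx => (Finset.mem_filter.1 hx).2)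
    have h2 : P * ((μH[1] (A \ K)).toReal + e) ≤ θ * (θ * c) := by
      calc P * ((μH[1] (A \ K)).toReal + e) ≤ P * (e + e) := by gcongr
        _ = θ * (θ * c) := by rw [he]; field_simp; ring
    have h3 := h1.trans h2
    rw [mul_div_assoc', div_le_iff₀ hN'] at h3
    have h4 : (F.card : ℝ) * (θ * c) ≤ θ * N * (θ * c) := by linarith
    exact le_of_mul_le_mul_right h4 (by positivity)
  -- Points of `H` move by less than `θc/N` while their mutual distances are at least `c/N`, so
  -- distances shrink at most by the factor `1 - 2 * θ`.
  have hπ : ∀ x, ∃ z, x ∈ H → z ∈ K ∧ dist x z < θ * c / N := by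
    intro x
    by_cases hx : x ∈ H
    · have := (Finset.mem_filter.1 hx).2
      push Not at this
      obtain ⟨z, hz, hz'⟩ := this
      exact ⟨z, fun _ => ⟨hz, hz'⟩⟩
    · exact ⟨x, fun h => absurd h hx⟩
  choose π hπ using hπ
  have hπdist : ∀ x ∈ H, ∀ y ∈ H, (1 - 2 * θ) * dist x y ≤ dist (π x) (π y) := by
    intro x hx y hy
    rcases eq_or_ne x y with rfl | hxy
    · simp
    have h1 := hGsep x (Finset.mem_filter.1 hx).1 y (Finset.mem_filter.1 hy).1 hxy
    have h2 := dist_triangle4 x (π x) (π y) y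
    have h3 := (hπ x hx).2
    have h4 := (hπ y hy).2
    rw [dist_comm] at h4
    have h5 : θ * (c / N) ≤ θ * dist x y := by gcongr
    rw [← mul_div_assoc] at h5
    linarith
  obtain ⟨hcardπ, hEπ⟩ := energy_image_le hs0 h2θ hπdist
  have hlow := hC (H.image π) (by
    intro z hz
    obtain ⟨x, hx, rfl⟩ := Finset.mem_image.1 hz
    exact (hπ x hx).1)
  -- The losses are at most `θN` each: points with close neighbours, points far from `K`, and the
  -- constant `C`.
  have hHN : (1 - 3 * θ) * N ≤ max (((H.image π).card : ℝ) - C) 0 := by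
    refine le_trans ?_ (le_max_left _ _)
    rw [hcardπ]
    linarith
  have hEH : energy s H ≤ energy s ω :=
    energy_mono ((Finset.filter_subset _ _).trans (Finset.filter_subset _ _))
  have hℓs := Real.rpow_pos_of_pos hℓ0 s
  have h2s := Real.rpow_pos_of_pos h2θ s
  have hchain : (1 - 2 * θ) ^ s * (partialZeta s κ *
      (((1 - 3 * θ) * N) ^ (1 + s) / ℓ ^ s)) ≤ energy s ω := by
    refine le_trans ?_ (hEπ.trans hEH)
    refine mul_le_mul_of_nonneg_left (le_trans ?_ hlow) h2s.le
    have := partialZeta_nonneg (s := s) κ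
    gcongr
  rw [Real.mul_rpow h3θ.le hN'.le] at hchain
  have hcontra : t * (N : ℝ) ^ (1 + s) < (1 - 2 * θ) ^ s * (partialZeta s κ *
      ((1 - 3 * θ) ^ (1 + s) * (N : ℝ) ^ (1 + s) / ℓ ^ s)) := by
    have : (1 - 2 * θ) ^ s * (partialZeta s κ *
        ((1 - 3 * θ) ^ (1 + s) * (N : ℝ) ^ (1 + s) / ℓ ^ s))
        = (1 - 2 * θ) ^ s * (1 - 3 * θ) ^ (1 + s) * partialZeta s κ / ℓ ^ s
          * (N : ℝ) ^ (1 + s) := by ring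
    rw [this]
    refine mul_lt_mul_of_pos_right ?_ hNs
    rwa [lt_div_iff₀ hℓs]
  linarith

end RieszEnergy

/-! ### Passage to the limit in the extended reals -/

theorem corollary2p5 (d' : ℕ) (M A : Set (EuclideanSpace ℝ (Fin d')))
    (hM : RieszEnergy.IsRectifiableManifold 1 M) (hAM : A ⊆ M) (hA : IsCompact A)
    (s : ℝ) (hs : 1 < s) :
    Tendsto (fun N : ℕ => RieszEnergy.minEnergy s A N / (N : ℝ≥0∞) ^ (1 + s)) atTop
      (𝓝 (ENNReal.ofReal (2 * (riemannZeta (s : ℂ)).re) / (μH[1] A) ^ s)) := by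
  have hs0 : 0 < s := by linarith
  have hfin := RieszEnergy.hausdorffMeasure_ne_top_of_rectifiable hM hAM hA
  set h := (μH[1] A).toReal with hh
  have hh0 : 0 ≤ h := ENNReal.toReal_nonneg
  set Z := 2 * (riemannZeta (s : ℂ)).re with hZ
  have hZ0 : 0 < Z := by
    have := (RieszEnergy.zeta_facts hs).1 1
    simp [RieszEnergy.partialZeta] at this
    linarith
  have hμ : (μH[1] A) ^ s = ENNReal.ofReal (h ^ s) := by
    rw [← ENNReal.ofReal_rpow_of_nonneg hh0 hs0.le, hh, ENNReal.ofReal_toReal hfin]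
  have hNpow : ∀ N : ℕ, 0 < N → (N : ℝ≥0∞) ^ (1 + s) = ENNReal.ofReal ((N : ℝ) ^ (1 + s)) := by
    intro N hN
    rw [← ENNReal.ofReal_rpow_of_nonneg (by positivity) (by linarith), ENNReal.ofReal_natCast]
  have hNpos : ∀ N : ℕ, 0 < N → 0 < (N : ℝ) ^ (1 + s) := fun N hN => by positivity
  rw [hμ]
  refine tendsto_order.2 ⟨fun a ha => ?_, fun b hb => ?_⟩
  · have hatop : a ≠ ∞ := ha.ne_top
    -- In product form the condition also covers `h = 0`, where the limit is `∞` and `a` is any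
    -- finite value.
    have ha' : a.toReal * h ^ s < Z := by
      rw [ENNReal.lt_div_iff_mul_lt (Or.inr hatop) (Or.inl ENNReal.ofReal_ne_top),
        ← ENNReal.ofReal_toReal hatop, ← ENNReal.ofReal_mul ENNReal.toReal_nonneg,
        ENNReal.ofReal_lt_ofReal_iff hZ0] at ha
      exact ha
    have hhs : 0 ≤ h ^ s := by positivity
    obtain ⟨t, hat, ht⟩ : ∃ t, a.toReal < t ∧ t * h ^ s < Z := by
      refine ⟨a.toReal + (Z - a.toReal * h ^ s) / (h ^ s + 1), ?_, ?_⟩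
      · have : 0 < (Z - a.toReal * h ^ s) / (h ^ s + 1) := div_pos (by linarith) (by linarith)
        linarith
      · have : (Z - a.toReal * h ^ s) / (h ^ s + 1) * h ^ s < Z - a.toReal * h ^ s := by
          rw [div_mul_eq_mul_div, div_lt_iff₀ (by linarith)]
          nlinarith
        linarith
    have ht0 : 0 < t := ENNReal.toReal_nonneg.trans_lt hat
    filter_upwards [RieszEnergy.eventually_le_energy hM hAM hA hs ht0 ht, eventually_gt_atTop 0]
      with N hN hN0
    have h1 : ENNReal.ofReal (t * (N : ℝ) ^ (1 + s)) ≤ RieszEnergy.minEnergy s A N :=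
      le_iInf fun ω => le_iInf fun hω => le_iInf fun hωA => ENNReal.ofReal_le_ofReal (hN ω hω hωA)
    have h2 : ENNReal.ofReal t ≤ RieszEnergy.minEnergy s A N / (N : ℝ≥0∞) ^ (1 + s) := by
      rw [hNpow N hN0, ENNReal.le_div_iff_mul_le (Or.inl (by simpa using hNpos N hN0))
        (Or.inl ENNReal.ofReal_ne_top), ← ENNReal.ofReal_mul ht0.le]
      exact h1
    refine lt_of_lt_of_le ?_ h2
    rw [← ENNReal.ofReal_toReal hatop]
    exact (ENNReal.ofReal_lt_ofReal_iff ht0).2 hat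
  · have hpos : 0 < h := by
      refine lt_of_le_of_ne hh0 fun h0 => ?_
      rw [← h0, Real.zero_rpow hs0.ne', ENNReal.ofReal_zero,
        ENNReal.div_zero (by simpa using hZ0)] at hb
      exact not_top_lt hb
    have hhs := Real.rpow_pos_of_pos hpos s
    obtain ⟨t, ht0, ht1, ht2⟩ := ENNReal.lt_iff_exists_real_btwn.1 hb
    have ht : Z < t * h ^ s := by
      rw [← ENNReal.ofReal_div_of_pos hhs] at ht1
      rw [← div_lt_iff₀ hhs]
      exact (ENNReal.ofReal_lt_ofReal_iff'.1 ht1).1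
    filter_upwards [RieszEnergy.eventually_exists_energy_le hM hAM hA hs hpos ht,
      eventually_gt_atTop 0] with N hN hN0
    obtain ⟨ω, hcard, hωA, hE⟩ := hN
    have h1 : RieszEnergy.minEnergy s A N ≤ ENNReal.ofReal (t * (N : ℝ) ^ (1 + s)) :=
      (iInf_le_of_le ω (iInf_le_of_le hcard (iInf_le _ hωA))).trans (ENNReal.ofReal_le_ofReal hE)
    refine lt_of_le_of_lt ?_ ht2
    rw [hNpow N hN0]
    refine ENNReal.div_le_of_le_mul ?_
    rwa [← ENNReal.ofReal_mul ht0]
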